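/- Work over $\mathbb{C}$ with commuting symbols $e_\alpha$, $\alpha\in\mathbb{Z}$, and let $S_k(e_\alpha,e_\beta)=\sum_{r=0}^{\infty}e_{\alpha+kr}e_{\beta-kr}$, a formal infinite sum. For $n\in\mathbb{N}$ and integers $\alpha,\beta$ put $$\{e_\alpha,e_\beta\}_1=\tfrac n2\big(S_1(e_{\alpha+1},e_\beta)-S_1(e_{\beta+1},e_\alpha)\big)+(\alpha-n)e_{\alpha+1}e_\beta-(\beta-n)e_\alpha e_{\beta+1},$$ $$\{e_{2\alpha},e_{2\beta}\}_2=0,$$ $$\{e_{2\alpha},e_{2\beta+3}\}_2=\tfrac n8\big(S_2(e_{2\beta+2},e_{2\alpha-2})-S_2(e_{2\alpha},e_{2\beta})\big)+\tfrac14(2\beta+1)e_{2\alpha}e_{2\beta},$$ $$\{e_{2\alpha+3},e_{2\beta+3}\}_2=\tfrac n4\big(S_2(e_{2\beta+2},e_{2\alpha+1})-S_2(e_{2\alpha+2},e_{2\beta+1})\big)-\tfrac14(2\alpha+1)e_{2\alpha}e_{2\beta+3}+\tfrac14(2\beta+1)e_{2\alpha+3}e_{2\beta},$$ $$\{e_{2\alpha},e_{2\beta}\}_3=0,$$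 $$\{e_{2\alpha},e_{2\beta+3}\}_3=\tfrac n8\big(S_2(e_{2\beta},e_{2\alpha-2})-S_2(e_{2\alpha},e_{2\beta-2})\big)+\tfrac12\beta\,e_{2\alpha}e_{2\beta-2},$$ $$\{e_{2\alpha+3},e_{2\beta+3}\}_3=\tfrac n4\big(S_2(e_{2\beta},e_{2\alpha+1})-S_2(e_{2\alpha},e_{2\beta+1})\big)-\tfrac12\alpha\,e_{2\alpha-2}e_{2\beta+3}+\tfrac12\beta\,e_{2\alpha+3}e_{2\beta-2},$$ and $\{e_{2\beta+3},e_{2\alpha}\}_i=-\{e_{2\alpha},e_{2\beta+3}\}_i$ for $i=2,3$. Proposition. Let $n\in\mathbb{N}$ and let $A_n$ be the polynomial algebra over $\mathbb{C}$ generated by $e_0$ and $e_\alpha$, $2\le\alpha\le n$. For each $i\in\{1,2,3\}$ and any two generators $e_\alpha,e_\beta$ of $A_n$, the expression $\{e_\alpha,e_\beta\}_i$ is, after cancellation in the differences of formal sums, an element of $A_n$, and there is exactly one Poisson bracket $\{\,,\}_i$ on $A_n$ (a $\mathbb{C}$-bilinear alternating operation satisfying the Jacobi identity and the Leibniz rule)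 with these values on the generators. Moreover, for all $\lambda_1,\lambda_2,\lambda_3\in\mathbb{C}$ the linear combination $\lambda_1\{\,,\}_1+\lambda_2\{\,,\}_2+\lambda_3\{\,,\}_3$ is a Poisson bracket on $A_n$. -/

import Mathlib

noncomputable section

namespace QuadraticPoisson

open MvPolynomial

/-- A Poisson bracket on a commutative `R`-algebra `A`: an `R`-bilinear map which is
alternating, satisfies the Jacobi identity and is a derivation in each argument (in the second
argument by the third field, hence in the first one by skew-symmetry). -/
structure IsPoissonBracket (R : Type*) {A : Type*} [CommRing R] [CommRing A] [Algebra R A]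
    (B : A →ₗ[R] A →ₗ[R] A) : Prop where
  alternating : ∀ f : A, B f f = 0
  jacobi : ∀ f g h : A, B f (B g h) + B g (B h f) + B h (B f g) = 0
  leibniz : ∀ f g h : A, B f (g * h) = B f g * h + g * B f h

/-- Possibly infinite formal linear combinations, over `ℂ`, of monomials in the generators
`e_α`, `α ∈ ℤ`. -/
abbrev FormalSeries : Type := MvPowerSeries ℤ ℂ

/-- The generator `e_α`. -/
def e (α : ℤ) : FormalSeries := MvPowerSeries.X α

/-- The formal infinite sum `S_k(e_α, e_β) = ∑_{r ≥ 0} e_{α + k r} e_{β - k r}`, formed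
coefficient by coefficient. For `k ≠ 0` every coefficient is a finite sum, see
`finite_support_S`. -/
def S (k : ℕ) (α β : ℤ) : FormalSeries :=
  fun m => ∑ᶠ r : ℕ, MvPowerSeries.coeff m (e (α + k * r) * e (β - k * r))

theorem finite_support_S (k : ℕ) (hk : k ≠ 0) (α β : ℤ) (m : ℤ →₀ ℕ) :
    (Function.support fun r : ℕ =>
      MvPowerSeries.coeff m (e (α + k * r) * e (β - k * r))).Finite := by
  have hinj : Function.Injective fun r : ℕ => α + (k : ℤ) * r := by
    intro r s h
    have h' : (k : ℤ) * r = k * s := by simpa using h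
    have hk' : (k : ℤ) ≠ 0 := by exact_mod_cast hk
    exact_mod_cast mul_left_cancel₀ hk' h'
  refine (m.support.finite_toSet.preimage (f := fun r : ℕ => α + (k : ℤ) * r)
    hinj.injOn).subset ?_
  intro r hr
  simp only [Set.mem_preimage, Finset.mem_coe, Finsupp.mem_support_iff]
  intro h0
  apply hr
  classical
  have hX : e (α + k * r) * e (β - k * r) = MvPowerSeries.monomial
      (Finsupp.single (α + k * r) 1 + Finsupp.single (β - k * r) 1) (1 : ℂ) := by
    simp [e, MvPowerSeries.X, MvPowerSeries.monomial_mul_monomial]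
  simp only [hX]
  rw [MvPowerSeries.coeff_monomial, if_neg]
  rintro rfl
  simp at h0

/-- The value of `{e_α, e_β}_1`. -/
def formula1 (n : ℂ) (α β : ℤ) : FormalSeries :=
  (n / 2) • (S 1 (α + 1) β - S 1 (β + 1) α)
    + ((α : ℂ) - n) • (e (α + 1) * e β) - ((β : ℂ) - n) • (e α * e (β + 1))

/-- The value of `{e_{2α}, e_{2β+3}}_2`. -/
def mixed2 (n : ℂ) (α β : ℤ) : FormalSeries :=
  (n / 8) • (S 2 (2 * β + 2) (2 * α - 2) - S 2 (2 * α) (2 * β))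
    + ((1 / 4 : ℂ) * (2 * β + 1)) • (e (2 * α) * e (2 * β))

/-- The value of `{e_{2α+3}, e_{2β+3}}_2`. -/
def odd2 (n : ℂ) (α β : ℤ) : FormalSeries :=
  (n / 4) • (S 2 (2 * β + 2) (2 * α + 1) - S 2 (2 * α + 2) (2 * β + 1))
    - ((1 / 4 : ℂ) * (2 * α + 1)) • (e (2 * α) * e (2 * β + 3))
    + ((1 / 4 : ℂ) * (2 * β + 1)) • (e (2 * α + 3) * e (2 * β))

/-- The value of `{e_{2α}, e_{2β+3}}_3`. -/
def mixed3 (n : ℂ) (α β : ℤ) : FormalSeries :=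
  (n / 8) • (S 2 (2 * β) (2 * α - 2) - S 2 (2 * α) (2 * β - 2))
    + ((1 / 2 : ℂ) * β) • (e (2 * α) * e (2 * β - 2))

/-- The value of `{e_{2α+3}, e_{2β+3}}_3`. -/
def odd3 (n : ℂ) (α β : ℤ) : FormalSeries :=
  (n / 4) • (S 2 (2 * β) (2 * α + 1) - S 2 (2 * α) (2 * β + 1))
    - ((1 / 2 : ℂ) * α) • (e (2 * α - 2) * e (2 * β + 3))
    + ((1 / 2 : ℂ) * β) • (e (2 * α + 3) * e (2 * β - 2))

/-- Given `mixed α β = {e_{2α}, e_{2β+3}}` and `odd α β = {e_{2α+3}, e_{2β+3}}`, the value of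
`{e_a, e_b}` for arbitrary integers `a`, `b`, where `{e_a, e_b} = 0` for `a`, `b` both even and
`{e_{2α+3}, e_{2β}} = -{e_{2β}, e_{2α+3}}`. All the divisions are exact. -/
def byParity (mixed odd : ℤ → ℤ → FormalSeries) (a b : ℤ) : FormalSeries :=
  if Even a then
    if Even b then 0 else mixed (a / 2) ((b - 3) / 2)
  else
    if Even b then -mixed (b / 2) ((a - 3) / 2) else odd ((a - 3) / 2) ((b - 3) / 2)

section
variable (mixed odd : ℤ → ℤ → FormalSeries) (α β : ℤ)

theorem byParity_even_even : byParity mixed odd (2 * α) (2 * β) = 0 := by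
  simp [byParity]

theorem byParity_even_odd : byParity mixed odd (2 * α) (2 * β + 3) = mixed α β := by
  have h : ¬ Even (2 * β + 3) := by rw [Int.even_iff]; omega
  simp [byParity, h]

theorem byParity_odd_even : byParity mixed odd (2 * α + 3) (2 * β) = -mixed β α := by
  have h : ¬ Even (2 * α + 3) := by rw [Int.even_iff]; omega
  simp [byParity, h]

theorem byParity_odd_odd : byParity mixed odd (2 * α + 3) (2 * β + 3) = odd α β := by
  have h : ¬ Even (2 * α + 3) := by rw [Int.even_iff]; omega
  have h' : ¬ Even (2 * β + 3) := by rw [Int.even_iff]; omega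
  simp [byParity, h, h']

end

/-- The value of `{e_a, e_b}_i` for `i = 1, 2, 3` (numbered here as `0, 1, 2 : Fin 3`). -/
def formula (n : ℂ) : Fin 3 → ℤ → ℤ → FormalSeries :=
  ![formula1 n, byParity (mixed2 n) (odd2 n), byParity (mixed3 n) (odd3 n)]

/-- The set of indices `{0} ∪ {2, …, n}`. -/
abbrev Index (n : ℕ) : Type := {a : ℤ // a = 0 ∨ (2 ≤ a ∧ a ≤ n)}

/-- The polynomial algebra over `ℂ` generated by `e_0` and `e_α`, `2 ≤ α ≤ n`. -/
abbrev PolyAlg (n : ℕ) : Type := MvPolynomial (Index n) ℂ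

/-- The inclusion of the polynomial algebra into formal series in all `e_α`, `α ∈ ℤ`. -/
def toSeries {n : ℕ} (p : PolyAlg n) : FormalSeries :=
  ((rename (Subtype.val : Index n → ℤ) p : MvPolynomial ℤ ℂ) : MvPowerSeries ℤ ℂ)

/-- The bilinear operation `B` takes on each pair of generators the value that the formulas for
`{ , }_i` prescribe. In particular, that value is a polynomial in the generators `e_0` and
`e_α`, `2 ≤ α ≤ n`. -/
def AgreesWithFormula (n : ℕ) (i : Fin 3)
    (B : PolyAlg n →ₗ[ℂ] PolyAlg n →ₗ[ℂ] PolyAlg n) : Prop :=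
  ∀ a b : Index n, toSeries (B (X a) (X b)) = formula (n : ℂ) i a b

end QuadraticPoisson

end

/-! The combination `{,}_1 - 4a{,}_2 - 4b{,}_3` belongs to the cubic `y² = x³ + ax + b`. The
generators stand for the functions with poles only at infinity: `x^k` for the index `2k`, `x^k y`
for `2k + 3`. There is no function of pole order 1, hence no `e_1`. A point of the curve gives a
vector, the values of these functions, and a quadratic form is studied through its polarisation at
pairs of such vectors. There the infinite sums telescope, and the bracket becomes an explicit
`kernel` in the values and the derivatives along the vector field `Dx = 2y`, `Dy = 3x² + a`
(`dirDeriv₂_curvePoly`).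

Polarised at three points, the Jacobi sum vanishes by a determinant identity, given only that `κ` is
antisymmetric and that its derivatives satisfy `κ' i j - κ' j i = ω i - ω j`
(`dirDeriv₃_jacobiSum`).

Nodal cubics `y² = (x - s)²(x + 2s)` suffice. They have the rational parametrisation `x = z² - 2s`,
`y = z(z² - 3s)`, so derivatives along the curve are ordinary ones and the functions become
polynomials in `z` of distinct degrees. Hence the points of the curve span, and the Jacobi identity
follows from its polarised form (`jacobiSum_nodalBracket`).

The nodal coefficients are `1, 12s², -8s³`. Their products run through six different powers of `s`,
so every symmetrised mixed Jacobi sum of the three brackets vanishes (`jacobiSum_sum_bracket`), and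
all linear combinations are Poisson.

That the values lie in `A_n` rests on telescoping, on the cancellation of `e_1`, and on coefficients
which vanish exactly when an index would leave the range. Uniqueness holds since a biderivation is
determined by its values on generators. -/

noncomputable section

namespace QuadraticPoisson

open MvPolynomial

/-! ### Alternating biderivations and Jacobi sums. -/

section Biderivation

variable {R A : Type*} [CommRing R] [CommRing A] [Algebra R A]

/-- An alternating bilinear operation satisfying the Leibniz rule. -/
structure IsAltBiderivation (B : A →ₗ[R] A →ₗ[R] A) : Prop where
  alternating : ∀ f : A, B f f = 0
  leibniz : ∀ f g h : A, B f (g * h) = B f g * h + g * B f h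

/-- The mixed Jacobi sum of two bilinear operations. -/
def jacobiSum (B B' : A →ₗ[R] A →ₗ[R] A) (f g h : A) : A :=
  B f (B' g h) + B g (B' h f) + B h (B' f g)

theorem jacobiSum_rotate (B B' : A →ₗ[R] A →ₗ[R] A) (f g h : A) :
    jacobiSum B B' f g h = jacobiSum B B' g h f := by
  simp only [jacobiSum]; ring

namespace IsAltBiderivation

variable {B : A →ₗ[R] A →ₗ[R] A}

theorem skew (hB : IsAltBiderivation B) (f g : A) : B f g = -B g f := by
  have h := hB.alternating (f + g)
  simp only [map_add, LinearMap.add_apply, hB.alternating, zero_add, add_zero] at h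
  exact eq_neg_of_add_eq_zero_right h

theorem leibniz_left (hB : IsAltBiderivation B) (f g h : A) :
    B (f * g) h = B f h * g + f * B g h := by
  rw [hB.skew, hB.leibniz, hB.skew h f, hB.skew h g]; ring

theorem smul (hB : IsAltBiderivation B) (c : R) : IsAltBiderivation (c • B) where
  alternating f := by simp [hB.alternating]
  leibniz f g h := by simp [hB.leibniz]

theorem add {B' : A →ₗ[R] A →ₗ[R] A} (hB : IsAltBiderivation B) (hB' : IsAltBiderivation B') :
    IsAltBiderivation (B + B') where
  alternating f := by simp [hB.alternating, hB'.alternating]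
  leibniz f g h := by simp only [LinearMap.add_apply, hB.leibniz, hB'.leibniz]; ring

theorem zero : IsAltBiderivation (0 : A →ₗ[R] A →ₗ[R] A) where
  alternating f := by simp
  leibniz f g h := by simp

theorem sum {ι : Type*} (s : Finset ι) {B : ι → A →ₗ[R] A →ₗ[R] A}
    (hB : ∀ i, IsAltBiderivation (B i)) : IsAltBiderivation (∑ i ∈ s, B i) :=
  Finset.sum_induction B IsAltBiderivation (fun _ _ => add) zero fun i _ => hB i

/-- The derivation `B f`. -/
def derivation (hB : IsAltBiderivation B) (f : A) : Derivation R A A :=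
  Derivation.mk' (B f) fun g h => by rw [hB.leibniz, smul_eq_mul, smul_eq_mul]; ring

@[simp]
theorem derivation_apply (hB : IsAltBiderivation B) (f g : A) : hB.derivation f g = B f g := rfl

/-- The Jacobi sum as a derivation in its first argument. -/
def jacobiDerivation (hB : IsAltBiderivation B) (g h : A) : Derivation R A A :=
  Derivation.mk' (B.flip (B g h) + B g ∘ₗ B h + B h ∘ₗ B.flip g) fun f f' => by
    simp only [LinearMap.add_apply, LinearMap.flip_apply, LinearMap.comp_apply,
      hB.leibniz_left, hB.leibniz, map_add, smul_eq_mul]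
    rw [hB.skew f g, hB.skew f' g]
    ring

end IsAltBiderivation

theorem IsPoissonBracket.isAltBiderivation {B : A →ₗ[R] A →ₗ[R] A} (hB : IsPoissonBracket R B) :
    IsAltBiderivation B := ⟨hB.alternating, hB.leibniz⟩

end Biderivation

/-! ### Biderivations of polynomial rings, determined by their values on generators. -/

section Polynomial

variable {R σ : Type*} [CommRing R]
  {B B' : MvPolynomial σ R →ₗ[R] MvPolynomial σ R →ₗ[R] MvPolynomial σ R}

theorem IsAltBiderivation.ext_X (hB : IsAltBiderivation B) (hB' : IsAltBiderivation B')
    (h : ∀ a b, B (X a) (X b) = B' (X a) (X b)) : B = B' := by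
  have h1 : ∀ a g, B (X a) g = B' (X a) g := fun a g =>
    DFunLike.congr_fun (MvPolynomial.derivation_ext (D₁ := hB.derivation (X a))
      (D₂ := hB'.derivation (X a)) (h a)) g
  refine LinearMap.ext fun f => LinearMap.ext fun g => ?_
  refine DFunLike.congr_fun (MvPolynomial.derivation_ext (D₁ := hB.derivation f)
      (D₂ := hB'.derivation f) fun b => ?_) g
  rw [hB.derivation_apply, hB'.derivation_apply, hB.skew, hB'.skew, h1]

/-- The Jacobi identity for an alternating biderivation of a polynomial ring can be checked on
the generators. -/
theorem IsAltBiderivation.isPoissonBracket (hB : IsAltBiderivation B)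
    (h : ∀ a b c, jacobiSum B B (X a) (X b) (X c) = 0) : IsPoissonBracket R B := by
  have step : ∀ g k, (∀ a, jacobiSum B B (X a) g k = 0) → ∀ f, jacobiSum B B f g k = 0 := by
    intro g k hg f
    exact DFunLike.congr_fun (MvPolynomial.derivation_ext (D₁ := hB.jacobiDerivation g k)
      (D₂ := 0) hg) f
  refine ⟨hB.alternating, fun f g k => ?_, hB.leibniz⟩
  -- The Jacobi sum is a derivation in its first argument; cyclic rotation brings each of the three
  -- arguments there in turn.
  refine step g k (fun a => ?_) f
  rw [jacobiSum_rotate]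
  refine step _ _ (fun b => ?_) g
  rw [jacobiSum_rotate]
  refine step _ _ (fun c => ?_) k
  rw [jacobiSum_rotate]
  exact h _ _ _

variable [Fintype σ]

/-- The biderivation with prescribed values on the pairs of generators. -/
def biderivationOfMatrix (Q : σ → σ → MvPolynomial σ R) :
    MvPolynomial σ R →ₗ[R] MvPolynomial σ R →ₗ[R] MvPolynomial σ R :=
  LinearMap.mk₂ R (fun f g => ∑ a, ∑ b, Q a b * pderiv a f * pderiv b g)
    (fun f f' g => by simp [mul_add, add_mul, Finset.sum_add_distrib])
    (fun c f g => by simp [Finset.smul_sum])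
    (fun f g g' => by simp [mul_add, Finset.sum_add_distrib])
    (fun c f g => by simp [Finset.smul_sum])

theorem biderivationOfMatrix_apply (Q : σ → σ → MvPolynomial σ R) (f g : MvPolynomial σ R) :
    biderivationOfMatrix Q f g = ∑ a, ∑ b, Q a b * pderiv a f * pderiv b g := rfl

theorem biderivationOfMatrix_X_X (Q : σ → σ → MvPolynomial σ R) (a b : σ) :
    biderivationOfMatrix Q (X a) (X b) = Q a b := by
  classical
  simp [biderivationOfMatrix_apply, pderiv_X, Pi.single_apply]

theorem isAltBiderivation_biderivationOfMatrix {Q : σ → σ → MvPolynomial σ R}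
    (h0 : ∀ a, Q a a = 0) (h : ∀ a b, Q a b = -Q b a) :
    IsAltBiderivation (biderivationOfMatrix Q) where
  alternating f := by
    classical
    rw [biderivationOfMatrix_apply, ← Finset.sum_product', Finset.univ_product_univ]
    -- Off-diagonal terms cancel in pairs under the swap; the fixed points are the diagonal terms,
    -- which vanish by `h0`.
    refine Finset.sum_involution (fun p _ => p.swap) ?_ ?_ (fun _ _ => Finset.mem_univ _)
      (fun p _ => Prod.swap_swap p)
    · rintro ⟨a, b⟩ -
      simp only [Prod.fst_swap, Prod.snd_swap]
      rw [h a b]; ring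
    · rintro ⟨a, b⟩ - hne heq
      obtain rfl : b = a := congrArg Prod.fst heq
      simp [h0] at hne
  leibniz f g k := by
    simp only [biderivationOfMatrix_apply, Derivation.leibniz, smul_eq_mul, Finset.sum_mul,
      Finset.mul_sum, ← Finset.sum_add_distrib]
    refine Finset.sum_congr rfl fun a _ => Finset.sum_congr rfl fun b _ => ?_
    ring

end Polynomial

/-! ### Differences of formal sums as finite sums. -/

theorem S_step {k : ℕ} (hk : k ≠ 0) (p q : ℤ) :
    S k p q = e p * e q + S k (p + k) (q - k) := by
  have key : ∀ f : ℕ → ℂ, f.support.Finite → ∑ᶠ r, f r = f 0 + ∑ᶠ r, f (r + 1) := by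
    intro f hf
    obtain ⟨N, hN⟩ := hf.bddAbove
    have h1 : f.support ⊆ ↑(Finset.range (N + 1 + 1)) := fun r hr => by
      have := hN hr
      simp only [Finset.coe_range, Set.mem_Iio]; omega
    have h2 : (fun r => f (r + 1)).support ⊆ ↑(Finset.range (N + 1)) := fun r hr => by
      have := hN (show r + 1 ∈ f.support from hr)
      simp only [Finset.coe_range, Set.mem_Iio]; omega
    rw [finsum_eq_sum_of_support_subset f h1, finsum_eq_sum_of_support_subset _ h2,
      Finset.sum_range_succ', add_comm]
  ext m
  rw [map_add]
  refine (key _ (finite_support_S k hk p q m)).trans ?_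
  congr 1
  · simp
  · refine finsum_congr fun r => ?_
    congr 3 <;> push_cast <;> ring

/-- The sum of `e_{p + k r} e_{q - k r}` over `0 ≤ r < m`, or minus the sum over `m ≤ r < 0`. -/
def signedSum (k : ℕ) (p q m : ℤ) : MvPolynomial ℤ ℂ :=
  ∑ r ∈ Finset.Ico 0 m, X (p + k * r) * X (q - k * r)
    - ∑ r ∈ Finset.Ico m 0, X (p + k * r) * X (q - k * r)

theorem signedSum_zero (k : ℕ) (p q : ℤ) : signedSum k p q 0 = 0 := by
  simp [signedSum]

/-- The sign convention for negative `m` makes this recursion valid for all integers, so later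
arguments need no case distinction on the order of `α` and `β`. -/
theorem signedSum_succ (k : ℕ) (p q m : ℤ) :
    signedSum k p q (m + 1) = signedSum k p q m + X (p + k * m) * X (q - k * m) := by
  simp only [signedSum]
  rcases le_or_gt 0 m with hm | hm
  · rw [Finset.Ico_eq_empty_of_le hm, Finset.Ico_eq_empty_of_le (show (0 : ℤ) ≤ m + 1 by omega),
      ← Finset.insert_Ico_right_eq_Ico_add_one hm, Finset.sum_insert (by simp)]
    ring
  · rw [Finset.Ico_eq_empty_of_le (a := 0) hm.le,
      Finset.Ico_eq_empty_of_le (a := 0) (show m + 1 ≤ 0 by omega),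
      ← Finset.insert_Ico_add_one_left_eq_Ico hm, Finset.sum_insert (by simp)]
    ring

/-- Functions on `ℤ` with the same value at `0` and the same differences agree. -/
theorem eq_of_succ_sub_eq {M : Type*} [AddCommGroup M] {f g : ℤ → M} (h0 : f 0 = g 0)
    (h : ∀ m, f (m + 1) - f m = g (m + 1) - g m) (m : ℤ) : f m = g m := by
  induction m with
  | zero => exact h0
  | succ i ih => have := h i; rwa [ih, sub_left_inj] at this
  | pred i ih =>
    have := h (-i - 1)
    rwa [sub_add_cancel, ih, sub_right_inj] at this

theorem signedSum_succ' (k : ℕ) (p q m : ℤ) :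
    signedSum k p q (m + 1) = X p * X q + signedSum k (p + k) (q - k) m := by
  refine eq_of_succ_sub_eq (f := fun m => signedSum k p q (m + 1))
    (g := fun m => X p * X q + signedSum k (p + k) (q - k) m) ?_ (fun m => ?_) m
  · simp only [signedSum_succ, signedSum_zero]; simp
  · simp only [signedSum_succ k p q (m + 1), signedSum_succ k _ _ m]
    rw [show p + k * (m + 1) = p + k + k * m by ring, show q - k * (m + 1) = q - k - k * m by ring]
    ring

/-- The two formal sums have the same tail, shifted by `m` steps. This is the cancellation that
makes the bracket values polynomials. -/
theorem coe_signedSum {k : ℕ} (hk : k ≠ 0) (p q m : ℤ) :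
    ((signedSum k p q m : MvPolynomial ℤ ℂ) : FormalSeries)
      = S k p q - S k (p + k * m) (q - k * m) := by
  refine eq_of_succ_sub_eq (f := fun m => ((signedSum k p q m : MvPolynomial ℤ ℂ) : FormalSeries))
    (g := fun m => S k p q - S k (p + k * m) (q - k * m)) ?_ (fun m => ?_) m
  · simp [signedSum_zero]
  · have h := S_step hk (p + k * m) (q - k * m)
    simp only [signedSum_succ]
    rw [show p + k * (m + 1) = p + k * m + k by ring, show q - k * (m + 1) = q - k * m - k by ring,
      h]
    push_cast
    simp only [e]
    ring

theorem coe_signedSum_of_eq {k : ℕ} (hk : k ≠ 0) {p q p' q' : ℤ} (m : ℤ) (hp : p' = p + k * m)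
    (hq : q' = q - k * m) :
    ((signedSum k p q m : MvPolynomial ℤ ℂ) : FormalSeries) = S k p q - S k p' q' := by
  rw [hp, hq, coe_signedSum hk]

/-! ### Polynomial forms of the prescribed bracket values and their antisymmetry. -/

section Formulas

variable (n : ℂ) (α β : ℤ)

/-- The polynomial form of `formula1`. -/
def poly1 : MvPolynomial ℤ ℂ :=
  (n / 2) • signedSum 1 (α + 1) β (β - α)
    + ((α : ℂ) - n) • (X (α + 1) * X β) - ((β : ℂ) - n) • (X α * X (β + 1))

/-- The polynomial form of `mixed2`. -/
def mixedPoly2 : MvPolynomial ℤ ℂ :=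
  (-(n / 8)) • signedSum 2 (2 * α) (2 * β) (β - α + 1)
    + ((1 / 4 : ℂ) * (2 * β + 1)) • (X (2 * α) * X (2 * β))

/-- The polynomial form of `odd2`. -/
def oddPoly2 : MvPolynomial ℤ ℂ :=
  (-(n / 4)) • signedSum 2 (2 * α + 2) (2 * β + 1) (β - α)
    - ((1 / 4 : ℂ) * (2 * α + 1)) • (X (2 * α) * X (2 * β + 3))
    + ((1 / 4 : ℂ) * (2 * β + 1)) • (X (2 * α + 3) * X (2 * β))

/-- The polynomial form of `mixed3`. -/
def mixedPoly3 : MvPolynomial ℤ ℂ :=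
  (-(n / 8)) • signedSum 2 (2 * α) (2 * β - 2) (β - α)
    + ((1 / 2 : ℂ) * β) • (X (2 * α) * X (2 * β - 2))

/-- The polynomial form of `odd3`. -/
def oddPoly3 : MvPolynomial ℤ ℂ :=
  (-(n / 4)) • signedSum 2 (2 * α) (2 * β + 1) (β - α)
    - ((1 / 2 : ℂ) * α) • (X (2 * α - 2) * X (2 * β + 3))
    + ((1 / 2 : ℂ) * β) • (X (2 * α + 3) * X (2 * β - 2))

/-- The polynomial form of `byParity`. -/
def byParityPoly (mixed odd : ℤ → ℤ → MvPolynomial ℤ ℂ) (a b : ℤ) : MvPolynomial ℤ ℂ :=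
  if Even a then
    if Even b then 0 else mixed (a / 2) ((b - 3) / 2)
  else
    if Even b then -mixed (b / 2) ((a - 3) / 2) else odd ((a - 3) / 2) ((b - 3) / 2)

/-- The polynomial form of `formula`. -/
def polyFormula (n : ℂ) : Fin 3 → ℤ → ℤ → MvPolynomial ℤ ℂ :=
  ![poly1 n, byParityPoly (mixedPoly2 n) (oddPoly2 n), byParityPoly (mixedPoly3 n) (oddPoly3 n)]

theorem coe_neg' (p : MvPolynomial ℤ ℂ) : ((-p : MvPolynomial ℤ ℂ) : FormalSeries) = -p :=
  map_neg (MvPolynomial.coeToMvPowerSeries.ringHom (σ := ℤ) (R := ℂ)) p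

theorem coe_sub' (p q : MvPolynomial ℤ ℂ) : ((p - q : MvPolynomial ℤ ℂ) : FormalSeries) = p - q :=
  map_sub (MvPolynomial.coeToMvPowerSeries.ringHom (σ := ℤ) (R := ℂ)) p q

theorem coe_poly1 : ((poly1 n α β : MvPolynomial ℤ ℂ) : FormalSeries) = formula1 n α β := by
  rw [poly1, formula1, coe_sub', MvPolynomial.coe_add, MvPolynomial.coe_smul,
    MvPolynomial.coe_smul, MvPolynomial.coe_smul,
    coe_signedSum_of_eq one_ne_zero (β - α) (p' := β + 1) (q' := α) (by push_cast; ring)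
      (by push_cast; ring)]
  simp [e]

theorem coe_mixedPoly2 :
    ((mixedPoly2 n α β : MvPolynomial ℤ ℂ) : FormalSeries) = mixed2 n α β := by
  rw [mixedPoly2, mixed2, MvPolynomial.coe_add, MvPolynomial.coe_smul,
    MvPolynomial.coe_smul,
    coe_signedSum_of_eq two_ne_zero (β - α + 1) (p' := 2 * β + 2) (q' := 2 * α - 2)
      (by push_cast; ring) (by push_cast; ring), neg_smul, ← smul_neg, neg_sub]
  simp [e]

theorem coe_oddPoly2 :
    ((oddPoly2 n α β : MvPolynomial ℤ ℂ) : FormalSeries) = odd2 n α β := by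
  rw [oddPoly2, odd2, MvPolynomial.coe_add, coe_sub', MvPolynomial.coe_smul,
    MvPolynomial.coe_smul, MvPolynomial.coe_smul,
    coe_signedSum_of_eq two_ne_zero (β - α) (p' := 2 * β + 2) (q' := 2 * α + 1)
      (by push_cast; ring) (by push_cast; ring), neg_smul, ← smul_neg, neg_sub]
  simp [e]

theorem coe_mixedPoly3 :
    ((mixedPoly3 n α β : MvPolynomial ℤ ℂ) : FormalSeries) = mixed3 n α β := by
  rw [mixedPoly3, mixed3, MvPolynomial.coe_add, MvPolynomial.coe_smul,
    MvPolynomial.coe_smul,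
    coe_signedSum_of_eq two_ne_zero (β - α) (p' := 2 * β) (q' := 2 * α - 2)
      (by push_cast; ring) (by push_cast; ring), neg_smul, ← smul_neg, neg_sub]
  simp [e]

theorem coe_oddPoly3 :
    ((oddPoly3 n α β : MvPolynomial ℤ ℂ) : FormalSeries) = odd3 n α β := by
  rw [oddPoly3, odd3, MvPolynomial.coe_add, coe_sub', MvPolynomial.coe_smul,
    MvPolynomial.coe_smul, MvPolynomial.coe_smul,
    coe_signedSum_of_eq two_ne_zero (β - α) (p' := 2 * β) (q' := 2 * α + 1)
      (by push_cast; ring) (by push_cast; ring), neg_smul, ← smul_neg, neg_sub]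
  simp [e]

theorem coe_polyFormula (i : Fin 3) :
    ((polyFormula n i α β : MvPolynomial ℤ ℂ) : FormalSeries) = formula n i α β := by
  fin_cases i
  · exact coe_poly1 n α β
  · simp only [polyFormula, formula, byParityPoly, byParity, Fin.mk_one, Matrix.cons_val_one,
      Matrix.cons_val_zero, Fin.isValue]
    split_ifs <;> simp only [MvPolynomial.coe_zero, coe_neg', coe_mixedPoly2, coe_oddPoly2]
  · simp only [polyFormula, formula, byParityPoly, byParity, Fin.reduceFinMk, Matrix.cons_val]
    split_ifs <;> simp only [MvPolynomial.coe_zero, coe_neg', coe_mixedPoly3, coe_oddPoly3]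

theorem formula1_swap : formula1 n β α = -formula1 n α β := by
  simp only [formula1, smul_sub, mul_comm (e (β + 1)) (e α), mul_comm (e (α + 1)) (e β)]
  abel

theorem odd2_swap : odd2 n β α = -odd2 n α β := by
  simp only [odd2, smul_sub, mul_comm (e (2 * β)), mul_comm (e (2 * β + 3))]
  abel

theorem odd3_swap : odd3 n β α = -odd3 n α β := by
  simp only [odd3, smul_sub, mul_comm (e (2 * β - 2)), mul_comm (e (2 * β + 3))]
  abel

theorem formula_swap (i : Fin 3) : formula n i β α = -formula n i α β := by
  fin_cases i
  · exact formula1_swap n α β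
  · simp only [formula, byParity, Fin.mk_one, Matrix.cons_val_one, Matrix.cons_val_zero]
    split_ifs
    exacts [neg_zero.symm, (neg_neg _).symm, rfl, odd2_swap n _ _]
  · simp only [formula, byParity, Fin.reduceFinMk, Matrix.cons_val]
    split_ifs
    exacts [neg_zero.symm, (neg_neg _).symm, rfl, odd3_swap n _ _]

theorem polyFormula_swap (i : Fin 3) : polyFormula n i β α = -polyFormula n i α β := by
  apply MvPolynomial.coe_injective
  rw [coe_neg', coe_polyFormula, coe_polyFormula, formula_swap]

end Formulas

/-! ### The bracket values are quadratic forms. -/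

section Homogeneous

theorem isHomogeneous_X_mul_X {σ : Type*} (a b : σ) :
    (X a * X b : MvPolynomial σ ℂ).IsHomogeneous 2 :=
  (isHomogeneous_X ℂ a).mul (isHomogeneous_X ℂ b)

theorem signedSum_mem {M : Submodule ℂ (MvPolynomial ℤ ℂ)} {k : ℕ} {p q m : ℤ}
    (h : ∀ r, (0 ≤ r ∧ r < m) ∨ (m ≤ r ∧ r < 0) → X (p + k * r) * X (q - k * r) ∈ M) :
    signedSum k p q m ∈ M :=
  M.sub_mem (M.sum_mem fun r hr => h r (Or.inl (Finset.mem_Ico.mp hr)))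
    (M.sum_mem fun r hr => h r (Or.inr (Finset.mem_Ico.mp hr)))

theorem isHomogeneous_polyFormula (n : ℂ) (i : Fin 3) (a b : ℤ) :
    (polyFormula n i a b).IsHomogeneous 2 := by
  have hX : ∀ a b : ℤ, (X a * X b : MvPolynomial ℤ ℂ) ∈ homogeneousSubmodule ℤ ℂ 2 :=
    fun a b => isHomogeneous_X_mul_X a b
  have hs : ∀ k p q m, signedSum k p q m ∈ homogeneousSubmodule ℤ ℂ 2 :=
    fun k p q m => signedSum_mem fun r _ => hX _ _
  have h0 : (0 : MvPolynomial ℤ ℂ) ∈ homogeneousSubmodule ℤ ℂ 2 := Submodule.zero_mem _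
  rw [← mem_homogeneousSubmodule]
  generalize homogeneousSubmodule ℤ ℂ 2 = M at *
  have m1 : ∀ c p q, c • (X p * X q) ∈ M := fun c p q => M.smul_mem c (hX p q)
  have m2 : ∀ c k p q m, c • signedSum k p q m ∈ M := fun c k p q m => M.smul_mem c (hs k p q m)
  fin_cases i
  · exact M.sub_mem (M.add_mem (m2 _ _ _ _ _) (m1 _ _ _)) (m1 _ _ _)
  · simp only [polyFormula, byParityPoly, Fin.mk_one, Matrix.cons_val_one, Matrix.cons_val_zero]
    have hm : ∀ α β, mixedPoly2 n α β ∈ M := fun α β => M.add_mem (m2 _ _ _ _ _) (m1 _ _ _)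
    have ho : ∀ α β, oddPoly2 n α β ∈ M := fun α β =>
      M.add_mem (M.sub_mem (m2 _ _ _ _ _) (m1 _ _ _)) (m1 _ _ _)
    split_ifs
    exacts [h0, hm _ _, M.neg_mem (hm _ _), ho _ _]
  · simp only [polyFormula, byParityPoly, Fin.reduceFinMk, Matrix.cons_val]
    have hm : ∀ α β, mixedPoly3 n α β ∈ M := fun α β => M.add_mem (m2 _ _ _ _ _) (m1 _ _ _)
    have ho : ∀ α β, oddPoly3 n α β ∈ M := fun α β =>
      M.add_mem (M.sub_mem (m2 _ _ _ _ _) (m1 _ _ _)) (m1 _ _ _)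
    split_ifs
    exacts [h0, hm _ _, M.neg_mem (hm _ _), ho _ _]

end Homogeneous

/-! ### The bracket values involve only the generators of `A_n`. -/

section Support

variable (n : ℕ)

/-- The polynomials in `e_0` and `e_α`, `2 ≤ α ≤ n`. -/
abbrev genAlg : Subalgebra ℂ (MvPolynomial ℤ ℂ) :=
  MvPolynomial.supported ℂ {a : ℤ | a = 0 ∨ (2 ≤ a ∧ a ≤ n)}

variable {n}

theorem X_mul_X_mem {a b : ℤ} (ha : a = 0 ∨ (2 ≤ a ∧ a ≤ n)) (hb : b = 0 ∨ (2 ≤ b ∧ b ≤ n)) :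
    (X a * X b : MvPolynomial ℤ ℂ) ∈ genAlg n :=
  mul_mem (MvPolynomial.X_mem_supported.mpr ha) (MvPolynomial.X_mem_supported.mpr hb)

theorem smul_X_mul_X_mem {c : ℂ} {a b : ℤ}
    (h : c ≠ 0 → (a = 0 ∨ (2 ≤ a ∧ a ≤ n)) ∧ (b = 0 ∨ (2 ≤ b ∧ b ≤ n))) :
    c • (X a * X b : MvPolynomial ℤ ℂ) ∈ genAlg n := by
  by_cases hc : c = 0
  · rw [hc, zero_smul]; exact zero_mem _
  · exact Subalgebra.smul_mem _ (X_mul_X_mem (h hc).1 (h hc).2) c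

theorem smul_signedSum_mem (c : ℂ) {k : ℕ} {p q m : ℤ}
    (h : ∀ r, (0 ≤ r ∧ r < m) ∨ (m ≤ r ∧ r < 0) →
      (p + k * r = 0 ∨ (2 ≤ p + k * r ∧ p + k * r ≤ n))
        ∧ (q - k * r = 0 ∨ (2 ≤ q - k * r ∧ q - k * r ≤ n))) :
    c • signedSum k p q m ∈ genAlg n :=
  Subalgebra.smul_mem _ (signedSum_mem (M := Subalgebra.toSubmodule (genAlg n))
    fun r hr => X_mul_X_mem (h r hr).1 (h r hr).2) c

/-- The sum contains `e_1 e_β` twice, as its first and as its last term. With the factor `n/2` this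
gives `n e_1 e_β`, which cancels the explicit term `-n e_1 e_β`. -/
theorem poly1_zero_mem {β : ℤ} (hβ : 2 ≤ β) (hn : β ≤ n) : poly1 n 0 β ∈ genAlg n := by
  have h : poly1 n 0 β = (n / 2 : ℂ) • signedSum 1 2 (β - 1) (β - 2)
      - ((β : ℂ) - n) • (X 0 * X (β + 1)) := by
    have h1 := signedSum_succ' 1 1 β (β - 1)
    have h2 := signedSum_succ 1 2 (β - 1) (β - 2)
    simp only [Nat.cast_one, one_mul, sub_add_cancel, show β - 2 + 1 = β - 1 by ring,
      show (1 : ℤ) + 1 = 2 by ring, show 2 + (β - 2) = β by ring,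
      show β - 1 - (β - 2) = 1 by ring] at h1 h2
    rw [poly1, zero_add, sub_zero, h1, h2, mul_comm (X β) (X 1)]
    module
  rw [h]
  refine sub_mem (smul_signedSum_mem _ fun r hr => ?_) (smul_X_mul_X_mem fun hc => ?_)
  · push_cast; omega
  -- The coefficient `β - n` removes `e_{β+1}` precisely when `β = n`.
  · have : β ≠ n := fun h => hc (by rw [h]; simp)
    omega

theorem poly1_mem {α β : ℤ} (hα : α = 0 ∨ (2 ≤ α ∧ α ≤ n)) (hβ : β = 0 ∨ (2 ≤ β ∧ β ≤ n)) :
    poly1 n α β ∈ genAlg n := by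
  rcases hα with rfl | hα <;> rcases hβ with rfl | hβ
  · have h : poly1 (n : ℂ) 0 0 = 0 := by
      simp [poly1, signedSum_zero, mul_comm (X (1 : ℤ)) (X (0 : ℤ))]
    rw [h]; exact zero_mem _
  · exact poly1_zero_mem hβ.1 hβ.2
  · rw [show poly1 (n : ℂ) α 0 = -poly1 (n : ℂ) 0 α from polyFormula_swap n 0 α 0]
    exact neg_mem (poly1_zero_mem hα.1 hα.2)
  · refine sub_mem (add_mem (smul_signedSum_mem _ fun r hr => ?_) (smul_X_mul_X_mem fun hc => ?_))
      (smul_X_mul_X_mem fun hc => ?_)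
    · push_cast; omega
    · have : α ≠ n := fun h => hc (by rw [h]; simp)
      omega
    · have : β ≠ n := fun h => hc (by rw [h]; simp)
      omega

theorem mixedPoly2_mem (c : ℂ) {α β : ℤ} (hα : 0 ≤ α ∧ 2 * α ≤ n) (hβ : 0 ≤ β ∧ 2 * β + 3 ≤ n) :
    mixedPoly2 c α β ∈ genAlg n := by
  refine add_mem (smul_signedSum_mem _ fun r hr => ?_) (smul_X_mul_X_mem fun _ => ?_)
  · push_cast; omega
  · omega

/-- With step 2, each factor keeps its parity; the even indices that occur are at least 0 and the
odd ones at least 3, so the index 1 is never met. -/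
theorem oddPoly2_mem (c : ℂ) {α β : ℤ} (hα : 0 ≤ α ∧ 2 * α + 3 ≤ n)
    (hβ : 0 ≤ β ∧ 2 * β + 3 ≤ n) : oddPoly2 c α β ∈ genAlg n := by
  refine add_mem (sub_mem (smul_signedSum_mem _ fun r hr => ?_) (smul_X_mul_X_mem fun _ => ?_))
    (smul_X_mul_X_mem fun _ => ?_)
  · push_cast; omega
  · omega
  · omega

theorem mixedPoly3_mem (c : ℂ) {α β : ℤ} (hα : 0 ≤ α ∧ 2 * α ≤ n) (hβ : 0 ≤ β ∧ 2 * β + 3 ≤ n) :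
    mixedPoly3 c α β ∈ genAlg n := by
  refine add_mem (smul_signedSum_mem _ fun r hr => ?_) (smul_X_mul_X_mem fun hc => ?_)
  · push_cast; omega
  -- The coefficient `β/2` removes the term with `e_{-2}`.
  · have : β ≠ 0 := fun h => hc (by rw [h]; simp)
    omega

theorem oddPoly3_mem (c : ℂ) {α β : ℤ} (hα : 0 ≤ α ∧ 2 * α + 3 ≤ n)
    (hβ : 0 ≤ β ∧ 2 * β + 3 ≤ n) : oddPoly3 c α β ∈ genAlg n := by
  refine add_mem (sub_mem (smul_signedSum_mem _ fun r hr => ?_) (smul_X_mul_X_mem fun hc => ?_))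
    (smul_X_mul_X_mem fun hc => ?_)
  · push_cast; omega
  · have : α ≠ 0 := fun h => hc (by rw [h]; simp)
    omega
  · have : β ≠ 0 := fun h => hc (by rw [h]; simp)
    omega

theorem byParityPoly_mem {mixed odd : ℤ → ℤ → MvPolynomial ℤ ℂ}
    (hm : ∀ {α β : ℤ}, (0 ≤ α ∧ 2 * α ≤ n) → (0 ≤ β ∧ 2 * β + 3 ≤ n) → mixed α β ∈ genAlg n)
    (ho : ∀ {α β : ℤ}, (0 ≤ α ∧ 2 * α + 3 ≤ n) → (0 ≤ β ∧ 2 * β + 3 ≤ n) → odd α β ∈ genAlg n)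
    {a b : ℤ} (ha : a = 0 ∨ (2 ≤ a ∧ a ≤ n)) (hb : b = 0 ∨ (2 ≤ b ∧ b ≤ n)) :
    byParityPoly mixed odd a b ∈ genAlg n := by
  unfold byParityPoly
  split_ifs with h1 h2 h2 <;> rw [Int.even_iff] at h1 h2
  · exact zero_mem _
  · exact hm (by omega) (by omega)
  · exact neg_mem (hm (by omega) (by omega))
  · exact ho (by omega) (by omega)

theorem polyFormula_mem (i : Fin 3) {a b : ℤ} (ha : a = 0 ∨ (2 ≤ a ∧ a ≤ n))
    (hb : b = 0 ∨ (2 ≤ b ∧ b ≤ n)) : polyFormula n i a b ∈ genAlg n := by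
  fin_cases i
  · exact poly1_mem ha hb
  · exact byParityPoly_mem (mixedPoly2_mem _) (oddPoly2_mem _) ha hb
  · exact byParityPoly_mem (mixedPoly3_mem _) (oddPoly3_mem _) ha hb

/-- The value of `{e_a, e_b}_i` as an element of the polynomial algebra. -/
theorem exists_rename_eq_polyFormula (i : Fin 3) (a b : Index n) :
    ∃ Q : PolyAlg n, rename (Subtype.val : Index n → ℤ) Q = polyFormula n i a b := by
  have h := polyFormula_mem i a.2 b.2
  rw [genAlg, MvPolynomial.supported_eq_range_rename] at h
  exact h

end Support

/-! ### Polarisation of quadratic brackets and the Jacobi identity for kernels. -/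

section Polarization

variable {σ : Type*}

/-- The derivative of polynomials in the constant direction `α`. -/
def dirDeriv (α : σ → ℂ) : Derivation ℂ (MvPolynomial σ ℂ) (MvPolynomial σ ℂ) :=
  mkDerivation ℂ fun a => C (α a)

@[simp]
theorem dirDeriv_X (α : σ → ℂ) (a : σ) : dirDeriv α (X a) = C (α a) := by
  simp [dirDeriv]

theorem dirDeriv_comm (α β : σ → ℂ) (p : MvPolynomial σ ℂ) :
    dirDeriv α (dirDeriv β p) = dirDeriv β (dirDeriv α p) := by
  have h : ⁅dirDeriv α, dirDeriv β⁆ = 0 :=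
    MvPolynomial.derivation_ext fun a => by simp [Derivation.commutator_apply]
  have h' := DFunLike.congr_fun h p
  rwa [Derivation.commutator_apply, Derivation.zero_apply, sub_eq_zero] at h'

theorem dirDeriv_dirDeriv_X_mul_X (α β : σ → ℂ) (a b : σ) :
    dirDeriv α (dirDeriv β (X a * X b)) = C (α a * β b + β a * α b) := by
  simp [Derivation.leibniz]
  ring

theorem pderiv_eq_dirDeriv [DecidableEq σ] (a : σ) :
    pderiv a = dirDeriv (Pi.single a 1 : σ → ℂ) :=
  MvPolynomial.derivation_ext fun b => by
    rw [dirDeriv_X, pderiv_X, Pi.single_apply, Pi.single_apply, apply_ite C, C_1, C_0]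

theorem dirDeriv_pderiv (α : σ → ℂ) (a : σ) (p : MvPolynomial σ ℂ) :
    dirDeriv α (pderiv a p) = pderiv a (dirDeriv α p) := by
  classical
  rw [pderiv_eq_dirDeriv, dirDeriv_comm]

variable [Fintype σ]

theorem derivation_eq_sum (D : Derivation ℂ (MvPolynomial σ ℂ) (MvPolynomial σ ℂ))
    (p : MvPolynomial σ ℂ) : D p = ∑ a, D (X a) * pderiv a p := by
  classical
  have hs : ∀ q, (∑ a, D (X a) • pderiv a :
      Derivation ℂ (MvPolynomial σ ℂ) (MvPolynomial σ ℂ)) q = ∑ a, D (X a) * pderiv a q := by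
    intro q
    rw [← Derivation.coeFnAddMonoidHom_apply, map_sum, Finset.sum_apply]
    rfl
  rw [← hs]
  refine DFunLike.congr_fun (MvPolynomial.derivation_ext fun b => ?_) p
  rw [hs]
  simp [pderiv_X, Pi.single_apply]

theorem dirDeriv_eq_sum (α : σ → ℂ) (p : MvPolynomial σ ℂ) :
    dirDeriv α p = ∑ a, C (α a) * pderiv a p := by
  rw [derivation_eq_sum]
  simp only [dirDeriv_X]

/-- The kernel of a quadratic bracket: its polarisation at two points of the curve, where two
functions take the values `f₁, f₂` and `g₁, g₂` and have the derivatives `f₁', f₂'` and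
`g₁', g₂'`. -/
def kernel (ν κ f₁ f₂ f₁' f₂' g₁ g₂ g₁' g₂' : ℂ) : ℂ :=
  ν * κ * (f₁ * g₂ - f₂ * g₁) + f₁' * g₂ - f₁ * g₂' + f₂' * g₁ - f₂ * g₁'

/-- The derivative of the kernel with respect to the first point. -/
def kernelDeriv (ν κ κ' f₁ f₂ f₁' f₂' f₁'' g₁ g₂ g₁' g₂' g₁'' : ℂ) : ℂ :=
  ν * κ' * (f₁ * g₂ - f₂ * g₁) + ν * κ * (f₁' * g₂ - f₂ * g₁')
    + f₁'' * g₂ - f₁' * g₂' + f₂' * g₁' - f₂ * g₁''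

/-- The polarisation at three points of the derivative of a quadratic form `q` along a quadratic
vector field which is given by a kernel. -/
theorem dirDeriv₃_derivation (D : Derivation ℂ (MvPolynomial σ ℂ) (MvPolynomial σ ℂ))
    (q : MvPolynomial σ ℂ) (ν : ℂ) (f f' : Fin 3 → ℂ) (κ : Fin 3 → Fin 3 → ℂ)
    (α α' : Fin 3 → σ → ℂ) (u v : Fin 3 → Fin 3 → ℂ)
    (hD : ∀ i j a, i ≠ j → dirDeriv (α i) (dirDeriv (α j) (D (X a))) =
      C (kernel ν (κ i j) (f i) (f j) (f' i) (f' j) (α i a) (α j a) (α' i a) (α' j a)))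
    (hu : ∀ i j, i ≠ j → dirDeriv (α i) (dirDeriv (α j) q) = C (u i j))
    (hv : ∀ i j, i ≠ j → dirDeriv (α i) (dirDeriv (α' j) q) = C (v i j)) :
    dirDeriv (α 0) (dirDeriv (α 1) (dirDeriv (α 2) (D q))) =
      C (ν * κ 0 1 * (f 0 * u 2 1 - f 1 * u 2 0) + f' 0 * u 2 1 - f 0 * v 2 1
            + f' 1 * u 2 0 - f 1 * v 2 0
        + (ν * κ 0 2 * (f 0 * u 1 2 - f 2 * u 1 0) + f' 0 * u 1 2 - f 0 * v 1 2
            + f' 2 * u 1 0 - f 2 * v 1 0)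
        + (ν * κ 1 2 * (f 1 * u 0 2 - f 2 * u 0 1) + f' 1 * u 0 2 - f 1 * v 0 2
            + f' 2 * u 0 1 - f 2 * v 0 1)) := by
  -- In `D q = ∑ D (X a) * ∂_a q` the first factor behaves as a quadratic form and the second as a
  -- linear one, so only distributions of two directions to the first and one to the second survive.
  have key : ∀ a, dirDeriv (α 0) (dirDeriv (α 1) (dirDeriv (α 2) (D (X a) * pderiv a q))) =
      dirDeriv (α 0) (dirDeriv (α 1) (D (X a))) * dirDeriv (α 2) (pderiv a q)
      + dirDeriv (α 0) (dirDeriv (α 2) (D (X a))) * dirDeriv (α 1) (pderiv a q)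
      + dirDeriv (α 1) (dirDeriv (α 2) (D (X a))) * dirDeriv (α 0) (pderiv a q) := by
    intro a
    have h1 : ∀ i j, i ≠ j → dirDeriv (α i) (dirDeriv (α j) (pderiv a q)) = 0 := by
      intro i j hij
      rw [dirDeriv_pderiv, dirDeriv_pderiv, hu i j hij, pderiv_C]
    have h2 := h1 0 1 (by decide)
    have h3 := h1 0 2 (by decide)
    have h4 := h1 1 2 (by decide)
    have h5 : dirDeriv (α 0) (dirDeriv (α 1) (dirDeriv (α 2) (D (X a)))) = 0 := by
      rw [hD 1 2 a (by decide), derivation_C]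
    simp only [Derivation.leibniz, smul_eq_mul, map_add, h2, h3, h4, h5, map_zero]
    ring
  -- The kernel is linear in the values `α j a`, `α' j a`, and contracting these with `∂_a` gives
  -- back a directional derivative of `q`.
  have hs : ∀ i j : Fin 3, i ≠ j → ∀ k,
      ∑ a, dirDeriv (α i) (dirDeriv (α j) (D (X a))) * dirDeriv (α k) (pderiv a q)
      = C (ν * κ i j) * (C (f i) * dirDeriv (α k) (dirDeriv (α j) q)
          - C (f j) * dirDeriv (α k) (dirDeriv (α i) q))
        + C (f' i) * dirDeriv (α k) (dirDeriv (α j) q)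
        - C (f i) * dirDeriv (α k) (dirDeriv (α' j) q)
        + C (f' j) * dirDeriv (α k) (dirDeriv (α i) q)
        - C (f j) * dirDeriv (α k) (dirDeriv (α' i) q) := by
    intro i j hij k
    have hsum : ∀ β : σ → ℂ, dirDeriv (α k) (dirDeriv β q) =
        ∑ a, C (β a) * dirDeriv (α k) (pderiv a q) := by
      intro β
      rw [dirDeriv_comm, dirDeriv_eq_sum β]
      simp only [dirDeriv_pderiv]
    simp only [hsum, Finset.mul_sum, ← Finset.sum_add_distrib, ← Finset.sum_sub_distrib]
    refine Finset.sum_congr rfl fun a _ => ?_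
    rw [hD i j a hij, kernel]
    simp only [map_add, map_sub, map_mul]
    ring
  rw [derivation_eq_sum D q]
  simp only [map_sum, key, Finset.sum_add_distrib]
  rw [hs 0 1 (by decide), hs 0 2 (by decide), hs 1 2 (by decide),
    hu 2 1 (by decide), hu 2 0 (by decide), hu 1 2 (by decide), hu 1 0 (by decide),
    hu 0 2 (by decide), hu 0 1 (by decide), hv 2 1 (by decide), hv 2 0 (by decide),
    hv 1 2 (by decide), hv 1 0 (by decide), hv 0 2 (by decide), hv 0 1 (by decide)]
  simp only [map_add, map_sub, map_mul]

/-- If a quadratic bracket is given by a kernel, the polarisation of its Jacobi sum at three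
points vanishes. -/
theorem dirDeriv₃_jacobiSum
    {B : MvPolynomial σ ℂ →ₗ[ℂ] MvPolynomial σ ℂ →ₗ[ℂ] MvPolynomial σ ℂ}
    (hB : IsAltBiderivation B) (ν : ℂ) (κ κ' : Fin 3 → Fin 3 → ℂ) (ω : Fin 3 → ℂ)
    (hκ : ∀ i j, κ j i = -κ i j) (hω : ∀ i j, i ≠ j → κ' i j - κ' j i = ω i - ω j)
    (α α' α'' : Fin 3 → σ → ℂ)
    (hK : ∀ i j a b, i ≠ j → dirDeriv (α i) (dirDeriv (α j) (B (X a) (X b))) =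
      C (kernel ν (κ i j) (α i a) (α j a) (α' i a) (α' j a) (α i b) (α j b) (α' i b) (α' j b)))
    (hK' : ∀ i j a b, i ≠ j → dirDeriv (α j) (dirDeriv (α' i) (B (X a) (X b))) =
      C (kernelDeriv ν (κ i j) (κ' i j) (α i a) (α j a) (α' i a) (α' j a) (α'' i a)
        (α i b) (α j b) (α' i b) (α' j b) (α'' i b))) (a b c : σ) :
    dirDeriv (α 0) (dirDeriv (α 1) (dirDeriv (α 2) (jacobiSum B B (X a) (X b) (X c)))) = 0 := by
  have h : ∀ a b c, _ := fun a b c => dirDeriv₃_derivation (hB.derivation (X a)) (B (X b) (X c)) ν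
    (fun i => α i a) (fun i => α' i a) κ α α' _ _ (fun i j d hij => hK i j a d hij)
    (fun i j hij => hK i j b c hij) (fun i j hij => hK' j i b c hij.symm)
  simp only [IsAltBiderivation.derivation_apply] at h
  simp only [jacobiSum, map_add, h]
  simp only [← map_add]
  rw [← C_0]
  congr 1
  have e1 := hω 0 1 (by decide)
  have e2 := hω 0 2 (by decide)
  have e3 := hω 1 2 (by decide)
  have e1' : κ' 0 1 = κ' 1 0 + ω 0 - ω 1 := by linear_combination e1
  have e2' : κ' 0 2 = κ' 2 0 + ω 0 - ω 2 := by linear_combination e2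
  have e3' : κ' 1 2 = κ' 2 1 + ω 1 - ω 2 := by linear_combination e3
  -- In the cyclic sum the terms quadratic in `ν` are expansions of one 3×3 determinant along
  -- different columns and cancel in pairs. The `κ'` enter only through their antisymmetrised
  -- differences, which contribute `(ω 0 - ω 1) + (ω 1 - ω 2) + (ω 2 - ω 0) = 0`.
  simp only [kernel, kernelDeriv, hκ 0 1, hκ 0 2, hκ 1 2, e1', e2', e3']
  ring

/-- Euler's identity shows that a form of positive degree with vanishing derivatives is zero. -/
theorem eq_zero_of_pderiv_eq_zero {p : MvPolynomial σ ℂ} {d : ℕ} (hp : p.IsHomogeneous d)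
    (hd : d ≠ 0) (h : ∀ a, pderiv a p = 0) : p = 0 := by
  have h1 := hp.sum_X_mul_pderiv
  simp only [h, mul_zero, Finset.sum_const_zero] at h1
  exact (smul_eq_zero.mp h1.symm).resolve_left hd

end Polarization

/-! ### Functions on the cubic curve and telescoping of polarised sums. -/

/-- Multiplication by `x` shifts the index of `curveFun` by 2, so sums of step 1 are split by parity
before they telescope. -/
theorem signedSum_one_two_mul (p q l : ℤ) :
    signedSum 1 p q (2 * l) = signedSum 2 p q l + signedSum 2 (p + 1) (q - 1) l := by
  refine eq_of_succ_sub_eq (f := fun l => signedSum 1 p q (2 * l))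
    (g := fun l => signedSum 2 p q l + signedSum 2 (p + 1) (q - 1) l) ?_ (fun l => ?_) l
  · simp only [mul_zero, signedSum_zero, add_zero]
  · simp only [show 2 * (l + 1) = 2 * l + 1 + 1 by ring, signedSum_succ]
    push_cast
    rw [show p + 1 * (2 * l + 1) = p + 1 + 2 * l by ring,
      show q - 1 * (2 * l + 1) = q - 1 - 2 * l by ring, one_mul]
    ring

theorem signedSum_one_two_mul_add_one (p q l : ℤ) :
    signedSum 1 p q (2 * l + 1) = signedSum 2 p q (l + 1) + signedSum 2 (p + 1) (q - 1) l := by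
  rw [signedSum_succ, signedSum_one_two_mul, signedSum_succ]
  push_cast
  rw [one_mul]
  ring

/-- The function with divisor of poles `i · ∞` on the curve `y² = x³ + a x + b`, where
`y = x η`: this is `x ^ k` for `i = 2 k` and `x ^ k y` for `i = 2 k + 3`. -/
def curveFun (x η : ℂ) (i : ℤ) : ℂ := x ^ (i / 2) * if Even i then 1 else η

/-- The derivative of `curveFun` along the vector field `D` with `D x = 2 y` and
`D y = 3 x² + a`. -/
def curveFunDeriv (a x η : ℂ) (i : ℤ) : ℂ :=
  if Even i then (i : ℂ) * (x ^ (i / 2) * η)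
  else x ^ ((i - 3) / 2) * (((i : ℂ) - 3) * x * η ^ 2 + 3 * x ^ 2 + a)

section

variable (a x η : ℂ) (k : ℤ)

theorem curveFun_even : curveFun x η (2 * k) = x ^ k := by
  simp [curveFun]

theorem curveFun_odd : curveFun x η (2 * k + 1) = x ^ k * η := by
  have h : ¬ Even (2 * k + 1) := by rw [Int.even_iff]; omega
  rw [curveFun, if_neg h, show (2 * k + 1) / 2 = k by omega]

theorem curveFunDeriv_even : curveFunDeriv a x η (2 * k) = 2 * k * (x ^ k * η) := by
  simp [curveFunDeriv]

theorem curveFunDeriv_odd :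
    curveFunDeriv a x η (2 * k + 3) = x ^ k * (2 * k * x * η ^ 2 + 3 * x ^ 2 + a) := by
  have h : ¬ Even (2 * k + 3) := by rw [Int.even_iff]; omega
  rw [curveFunDeriv, if_neg h, show (2 * k + 3 - 3) / 2 = k by omega]
  push_cast
  ring

variable {x}

theorem curveFun_add_two (hx : x ≠ 0) : curveFun x η (k + 2) = x * curveFun x η k := by
  rw [curveFun, curveFun, show (k + 2) / 2 = k / 2 + 1 by omega, zpow_add_one₀ hx]
  have : Even (k + 2) ↔ Even k := by simp
  simp only [this]
  ring

/-- All values are written through the single power `x ^ k`, which can then be replaced by a free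
variable; what remains is a rational identity. -/
theorem curveFun_shifts (hx : x ≠ 0) : curveFun x η (2 * k + 2) = x ^ k * x ∧
    curveFun x η (2 * k + 3) = x ^ k * x * η ∧ curveFun x η (2 * k + 4) = x ^ k * x ^ 2 ∧
    curveFun x η (2 * k + 5) = x ^ k * x ^ 2 * η ∧ curveFun x η (2 * k - 2) = x ^ k * x⁻¹ := by
  have e : ∀ i, curveFun x η (i + 2) = x * curveFun x η i := fun i => curveFun_add_two η i hx
  refine ⟨?_, ?_, ?_, ?_, ?_⟩
  · rw [e, curveFun_even]; ring
  · rw [show 2 * k + 3 = 2 * k + 1 + 2 by ring, e, curveFun_odd]; ring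
  · rw [show 2 * k + 4 = 2 * k + 2 + 2 by ring, e, e, curveFun_even]; ring
  · rw [show 2 * k + 5 = 2 * k + 1 + 2 + 2 by ring, e, e, curveFun_odd]; ring
  · have h := e (2 * k - 2)
    rw [sub_add_cancel, curveFun_even] at h
    rw [h]; field_simp

end

section Kernel

variable {φ ψ : ℤ → ℂ} {x₁ x₂ : ℂ}

/-- The telescoping of the polarised sums. -/
theorem dirDeriv₂_signedSum_two (h₁ : ∀ i, φ (i + 2) = x₁ * φ i) (h₂ : ∀ i, ψ (i + 2) = x₂ * ψ i)
    (hx : x₁ ≠ x₂) (p q m p' q' : ℤ) (hp : p' = p + 2 * m) (hq : q' = q + 2 - 2 * m) :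
    dirDeriv φ (dirDeriv ψ (signedSum 2 p q m)) =
      C ((φ p' * ψ q' - ψ p' * φ q' - (φ p * ψ (q + 2) - ψ p * φ (q + 2))) / (x₁ - x₂)) := by
  subst hp hq
  refine eq_of_succ_sub_eq (f := fun m => dirDeriv φ (dirDeriv ψ (signedSum 2 p q m)))
    (g := fun m => C ((φ (p + 2 * m) * ψ (q + 2 - 2 * m) - ψ (p + 2 * m) * φ (q + 2 - 2 * m)
      - (φ p * ψ (q + 2) - ψ p * φ (q + 2))) / (x₁ - x₂))) ?_ (fun m => ?_) m
  · simp [signedSum_zero]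
  · have hx' : x₁ - x₂ ≠ 0 := sub_ne_zero.mpr hx
    simp only [signedSum_succ, map_add, dirDeriv_dirDeriv_X_mul_X, add_sub_cancel_left]
    simp only [← map_add, ← map_sub]
    congr 1
    push_cast
    -- Multiplied by `x₁ - x₂`, the symmetrised term at `(P, Q)` is the antisymmetrised term at `(P
    -- + 2, Q)` minus the one at `(P, Q + 2)`.
    rw [show p + 2 * (m + 1) = p + 2 * m + 2 by ring, show q + 2 - 2 * (m + 1) = q - 2 * m by ring,
      show q + 2 - 2 * m = q - 2 * m + 2 by ring, h₁, h₂, h₁ (q - 2 * m), h₂ (q - 2 * m)]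
    field_simp
    ring

end Kernel

/-! ### The kernel of the bracket attached to a cubic curve. -/

theorem byParityPoly_even_even (mixed odd : ℤ → ℤ → MvPolynomial ℤ ℂ) (α β : ℤ) :
    byParityPoly mixed odd (2 * α) (2 * β) = 0 := by
  simp [byParityPoly]

theorem byParityPoly_even_odd (mixed odd : ℤ → ℤ → MvPolynomial ℤ ℂ) (α β : ℤ) :
    byParityPoly mixed odd (2 * α) (2 * β + 3) = mixed α β := by
  have h : ¬ Even (2 * β + 3) := by rw [Int.even_iff]; omega
  simp [byParityPoly, h]

theorem byParityPoly_odd_odd (mixed odd : ℤ → ℤ → MvPolynomial ℤ ℂ) (α β : ℤ) :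
    byParityPoly mixed odd (2 * α + 3) (2 * β + 3) = odd α β := by
  have h : ¬ Even (2 * α + 3) := by rw [Int.even_iff]; omega
  have h' : ¬ Even (2 * β + 3) := by rw [Int.even_iff]; omega
  simp [byParityPoly, h, h']

/-- The value on generators of the bracket attached to the curve `y² = x³ + a x + b`. -/
def curvePoly (n a b : ℂ) (i j : ℤ) : MvPolynomial ℤ ℂ :=
  polyFormula n 0 i j + (-4 * a) • polyFormula n 1 i j + (-4 * b) • polyFormula n 2 i j

section CurveKernel

variable {n a b x₁ x₂ η₁ η₂ : ℂ}

/-- The kernel of the bracket attached to the curve `y² = x³ + a x + b`. -/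
def curveKernel (n a x₁ x₂ η₁ η₂ : ℂ) (i j : ℤ) : ℂ :=
  kernel n (-(x₁ * η₁ + x₂ * η₂) / (x₁ - x₂)) (curveFun x₁ η₁ i) (curveFun x₂ η₂ i)
    (curveFunDeriv a x₁ η₁ i) (curveFunDeriv a x₂ η₂ i) (curveFun x₁ η₁ j) (curveFun x₂ η₂ j)
    (curveFunDeriv a x₁ η₁ j) (curveFunDeriv a x₂ η₂ j)

/-- Only the first bracket contributes and `curveFunDeriv` does not involve `a` on even indices, so
the curve equation plays no role. -/
theorem dirDeriv₂_curvePoly_even_even (h₁ : x₁ ≠ 0) (h₂ : x₂ ≠ 0) (hx : x₁ ≠ x₂) (A B : ℤ) :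
    dirDeriv (curveFun x₁ η₁) (dirDeriv (curveFun x₂ η₂) (curvePoly n a b (2 * A) (2 * B))) =
      C (curveKernel n a x₁ x₂ η₁ η₂ (2 * A) (2 * B)) := by
  have hx' : x₁ - x₂ ≠ 0 := sub_ne_zero.mpr hx
  have hs := dirDeriv₂_signedSum_two (fun i => curveFun_add_two η₁ i h₁)
    (fun i => curveFun_add_two η₂ i h₂) hx
  have a1 := (curveFun_shifts η₁ A h₁).1
  have b1 := (curveFun_shifts η₁ B h₁).1
  have c1 := (curveFun_shifts η₂ A h₂).1
  have d1 := (curveFun_shifts η₂ B h₂).1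
  simp only [curvePoly, polyFormula, Matrix.cons_val, byParityPoly_even_even, poly1, smul_zero,
    add_zero, show 2 * B - 2 * A = 2 * (B - A) by ring, signedSum_one_two_mul]
  simp only [map_add, map_sub, Derivation.map_smul, dirDeriv_dirDeriv_X_mul_X,
    hs (2 * A + 1) (2 * B) (B - A) (2 * B + 1) (2 * A + 2) (by ring) (by ring),
    hs (2 * A + 1 + 1) (2 * B - 1) (B - A) (2 * B + 2) (2 * A + 1) (by ring) (by ring)]
  rw [show 2 * A + 1 + 1 = 2 * A + 2 by ring, show 2 * B - 1 + 2 = 2 * B + 1 by ring]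
  simp only [smul_eq_C_mul, ← map_mul, ← map_add, ← map_sub]
  congr 1
  simp only [curveKernel, kernel, curveFun_even, curveFun_odd, curveFunDeriv_even, a1, b1, c1, d1]
  generalize x₁ ^ A = u₁
  generalize x₂ ^ A = u₂
  generalize x₁ ^ B = v₁
  generalize x₂ ^ B = v₂
  push_cast
  field_simp
  ring

theorem dirDeriv₂_curvePoly_even_odd (h₁ : x₁ ≠ 0) (h₂ : x₂ ≠ 0) (hx : x₁ ≠ x₂)
    (hc₁ : x₁ ^ 2 * η₁ ^ 2 = x₁ ^ 3 + a * x₁ + b) (hc₂ : x₂ ^ 2 * η₂ ^ 2 = x₂ ^ 3 + a * x₂ + b)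
    (A B : ℤ) :
    dirDeriv (curveFun x₁ η₁) (dirDeriv (curveFun x₂ η₂) (curvePoly n a b (2 * A) (2 * B + 3))) =
      C (curveKernel n a x₁ x₂ η₁ η₂ (2 * A) (2 * B + 3)) := by
  have hx' : x₁ - x₂ ≠ 0 := sub_ne_zero.mpr hx
  have hs := dirDeriv₂_signedSum_two (fun i => curveFun_add_two η₁ i h₁)
    (fun i => curveFun_add_two η₂ i h₂) hx
  have a1 := (curveFun_shifts η₁ A h₁).1
  obtain ⟨b1, b2, b3, b4, b5⟩ := curveFun_shifts η₁ B h₁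
  have c1 := (curveFun_shifts η₂ A h₂).1
  obtain ⟨d1, d2, d3, d4, d5⟩ := curveFun_shifts η₂ B h₂
  simp only [curvePoly, polyFormula, Matrix.cons_val, byParityPoly_even_odd, poly1, mixedPoly2,
    mixedPoly3,
    show 2 * B + 3 - 2 * A = 2 * (B - A + 1) + 1 by ring, signedSum_one_two_mul_add_one]
  simp only [map_add, map_sub, Derivation.map_smul, dirDeriv_dirDeriv_X_mul_X,
    hs (2 * A + 1) (2 * B + 3) (B - A + 1 + 1) (2 * B + 5) (2 * A + 1) (by ring) (by ring),
    hs (2 * A + 1 + 1) (2 * B + 3 - 1) (B - A + 1) (2 * B + 4) (2 * A + 2) (by ring) (by ring),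
    hs (2 * A) (2 * B) (B - A + 1) (2 * B + 2) (2 * A) (by ring) (by ring),
    hs (2 * A) (2 * B - 2) (B - A) (2 * B) (2 * A) (by ring) (by ring)]
  rw [show 2 * A + 1 + 1 = 2 * A + 2 by ring, show 2 * B + 3 - 1 + 2 = 2 * B + 4 by ring,
    show 2 * B + 3 + 2 = 2 * B + 5 by ring, show 2 * B - 2 + 2 = 2 * B by ring,
    show 2 * B + 3 + 1 = 2 * B + 4 by ring]
  simp only [smul_eq_C_mul, ← map_mul, ← map_add, ← map_sub]
  congr 1
  simp only [curveKernel, kernel, curveFun_even, curveFun_odd, curveFunDeriv_even,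
    curveFunDeriv_odd, a1, b1, b2, b3, b4, b5, c1,
    d1, d2, d3, d4, d5]
  generalize x₁ ^ A = u₁
  generalize x₂ ^ A = u₂
  generalize x₁ ^ B = v₁
  generalize x₂ ^ B = v₂
  -- Two points with different `x` determine `b` and `a`. After elimination the points are free
  -- variables and the claim is an identity of rational functions.
  obtain rfl : b = x₁ ^ 2 * η₁ ^ 2 - x₁ ^ 3 - a * x₁ := by linear_combination -hc₁
  obtain rfl : a = ((x₁ ^ 2 * η₁ ^ 2 - x₁ ^ 3) - (x₂ ^ 2 * η₂ ^ 2 - x₂ ^ 3)) / (x₁ - x₂) := by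
    rw [eq_div_iff hx']; linear_combination hc₂
  push_cast
  field_simp
  ring

theorem dirDeriv₂_curvePoly_odd_odd (h₁ : x₁ ≠ 0) (h₂ : x₂ ≠ 0) (hx : x₁ ≠ x₂)
    (hc₁ : x₁ ^ 2 * η₁ ^ 2 = x₁ ^ 3 + a * x₁ + b) (hc₂ : x₂ ^ 2 * η₂ ^ 2 = x₂ ^ 3 + a * x₂ + b)
    (A B : ℤ) :
    dirDeriv (curveFun x₁ η₁)
      (dirDeriv (curveFun x₂ η₂) (curvePoly n a b (2 * A + 3) (2 * B + 3))) =
      C (curveKernel n a x₁ x₂ η₁ η₂ (2 * A + 3) (2 * B + 3)) := by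
  have hx' : x₁ - x₂ ≠ 0 := sub_ne_zero.mpr hx
  have hs := dirDeriv₂_signedSum_two (fun i => curveFun_add_two η₁ i h₁)
    (fun i => curveFun_add_two η₂ i h₂) hx
  obtain ⟨a1, a2, a3, a4, a5⟩ := curveFun_shifts η₁ A h₁
  obtain ⟨b1, b2, b3, b4, b5⟩ := curveFun_shifts η₁ B h₁
  obtain ⟨c1, c2, c3, c4, c5⟩ := curveFun_shifts η₂ A h₂
  obtain ⟨d1, d2, d3, d4, d5⟩ := curveFun_shifts η₂ B h₂
  simp only [curvePoly, polyFormula, Matrix.cons_val, byParityPoly_odd_odd, poly1, oddPoly2,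
    oddPoly3, show 2 * B + 3 - (2 * A + 3) = 2 * (B - A) by ring, signedSum_one_two_mul]
  simp only [map_add, map_sub, Derivation.map_smul, dirDeriv_dirDeriv_X_mul_X,
    hs (2 * A + 3 + 1) (2 * B + 3) (B - A) (2 * B + 4) (2 * A + 5) (by ring) (by ring),
    hs (2 * A + 3 + 1 + 1) (2 * B + 3 - 1) (B - A) (2 * B + 5) (2 * A + 4) (by ring) (by ring),
    hs (2 * A + 2) (2 * B + 1) (B - A) (2 * B + 2) (2 * A + 3) (by ring) (by ring),
    hs (2 * A) (2 * B + 1) (B - A) (2 * B) (2 * A + 3) (by ring) (by ring)]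
  rw [show 2 * A + 3 + 1 = 2 * A + 4 by ring, show 2 * A + 4 + 1 = 2 * A + 5 by ring,
    show 2 * B + 3 - 1 + 2 = 2 * B + 4 by ring,
    show 2 * B + 3 + 2 = 2 * B + 5 by ring, show 2 * B + 1 + 2 = 2 * B + 3 by ring,
    show 2 * B + 3 + 1 = 2 * B + 4 by ring]
  simp only [smul_eq_C_mul, ← map_mul, ← map_add, ← map_sub]
  congr 1
  simp only [curveKernel, kernel, curveFun_even, curveFunDeriv_odd, a1, a2, a3, a4, a5, b1, b2,
    b3, b4, b5, c1, c2, c3, c4, c5, d1, d2, d3, d4, d5]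
  generalize x₁ ^ A = u₁
  generalize x₂ ^ A = u₂
  generalize x₁ ^ B = v₁
  generalize x₂ ^ B = v₂
  obtain rfl : b = x₁ ^ 2 * η₁ ^ 2 - x₁ ^ 3 - a * x₁ := by linear_combination -hc₁
  obtain rfl : a = ((x₁ ^ 2 * η₁ ^ 2 - x₁ ^ 3) - (x₂ ^ 2 * η₂ ^ 2 - x₂ ^ 3)) / (x₁ - x₂) := by
    rw [eq_div_iff hx']; linear_combination hc₂
  push_cast
  field_simp
  ring

theorem curvePoly_swap (n a b : ℂ) (i j : ℤ) : curvePoly n a b j i = -curvePoly n a b i j := by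
  simp only [curvePoly, polyFormula_swap n i j, smul_neg, neg_add]

theorem curveKernel_swap (n a x₁ x₂ η₁ η₂ : ℂ) (i j : ℤ) :
    curveKernel n a x₁ x₂ η₁ η₂ j i = -curveKernel n a x₁ x₂ η₁ η₂ i j := by
  simp only [curveKernel, kernel]; ring

/-- The bracket attached to the curve `y² = x³ + a x + b` is given by `curveKernel`. -/
theorem dirDeriv₂_curvePoly (h₁ : x₁ ≠ 0) (h₂ : x₂ ≠ 0) (hx : x₁ ≠ x₂)
    (hc₁ : x₁ ^ 2 * η₁ ^ 2 = x₁ ^ 3 + a * x₁ + b) (hc₂ : x₂ ^ 2 * η₂ ^ 2 = x₂ ^ 3 + a * x₂ + b)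
    (i j : ℤ) :
    dirDeriv (curveFun x₁ η₁) (dirDeriv (curveFun x₂ η₂) (curvePoly n a b i j)) =
      C (curveKernel n a x₁ x₂ η₁ η₂ i j) := by
  have h : ∀ i : ℤ, (∃ k, i = 2 * k) ∨ ∃ k, i = 2 * k + 3 := fun i => by
    rcases Int.even_or_odd' i with ⟨k, h | h⟩
    · exact Or.inl ⟨k, h⟩
    · exact Or.inr ⟨k - 1, by omega⟩
  rcases h i with ⟨A, rfl⟩ | ⟨A, rfl⟩ <;> rcases h j with ⟨B, rfl⟩ | ⟨B, rfl⟩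
  · exact dirDeriv₂_curvePoly_even_even h₁ h₂ hx A B
  · exact dirDeriv₂_curvePoly_even_odd h₁ h₂ hx hc₁ hc₂ A B
  · rw [curvePoly_swap, curveKernel_swap, map_neg, map_neg, map_neg,
      dirDeriv₂_curvePoly_even_odd h₁ h₂ hx hc₁ hc₂]
  · exact dirDeriv₂_curvePoly_odd_odd h₁ h₂ hx hc₁ hc₂ A B

end CurveKernel

/-! ### Degrees of derivatives and of the Jacobi sum. -/

section Homogeneous

variable {σ : Type*} [Fintype σ]

theorem isHomogeneous_dirDeriv {p : MvPolynomial σ ℂ} {d : ℕ} (hp : p.IsHomogeneous d)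
    (α : σ → ℂ) : (dirDeriv α p).IsHomogeneous (d - 1) := by
  rw [dirDeriv_eq_sum]
  refine IsHomogeneous.sum _ _ _ fun a _ => ?_
  simpa using (isHomogeneous_C σ (α a)).mul (hp.pderiv (i := a))

/-- The linear dependence on the direction, with constants `q` independent of `α`, is what allows
differentiation when the direction moves along the curve. -/
theorem exists_dirDeriv_eq_C {p : MvPolynomial σ ℂ} (hp : p.IsHomogeneous 1) :
    ∃ q : σ → ℂ, ∀ α : σ → ℂ, dirDeriv α p = C (∑ a, α a * q a) := by
  refine ⟨fun a => coeff 0 (pderiv a p), fun α => ?_⟩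
  rw [dirDeriv_eq_sum, map_sum]
  refine Finset.sum_congr rfl fun a _ => ?_
  rw [C_mul]
  congr 1
  exact totalDegree_eq_zero_iff_eq_C.mp
    (Nat.le_zero.mp (hp.pderiv (i := a)).totalDegree_le)

theorem isHomogeneous_derivation {D : Derivation ℂ (MvPolynomial σ ℂ) (MvPolynomial σ ℂ)}
    (hD : ∀ a, (D (X a)).IsHomogeneous 2) {p : MvPolynomial σ ℂ} (hp : p.IsHomogeneous 2) :
    (D p).IsHomogeneous 3 := by
  rw [derivation_eq_sum]
  exact IsHomogeneous.sum _ _ _ fun a _ => (hD a).mul (hp.pderiv (i := a))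

theorem isHomogeneous_jacobiSum
    {B : MvPolynomial σ ℂ →ₗ[ℂ] MvPolynomial σ ℂ →ₗ[ℂ] MvPolynomial σ ℂ}
    (hB : IsAltBiderivation B) (h : ∀ a b, (B (X a) (X b)).IsHomogeneous 2) (a b c : σ) :
    (jacobiSum B B (X a) (X b) (X c)).IsHomogeneous 3 := by
  have key : ∀ a b c, (B (X a) (B (X b) (X c))).IsHomogeneous 3 := fun a b c =>
    isHomogeneous_derivation (D := hB.derivation (X a)) (h a) (h b c)
  exact ((key a b c).add (key b c a)).add (key c a b)

end Homogeneous

theorem rename_dirDeriv {σ τ : Type*} (f : σ → τ) (α : τ → ℂ) (p : MvPolynomial σ ℂ) :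
    rename f (dirDeriv (α ∘ f) p) = dirDeriv α (rename f p) := by
  induction p using MvPolynomial.induction_on with
  | C c => simp [derivation_C]
  | add p q hp hq => simp only [map_add, hp, hq]
  | mul_X p a hp =>
    simp only [Derivation.leibniz, map_mul, rename_X, dirDeriv_X, map_add, smul_eq_mul, hp,
      rename_C, Function.comp_apply]

/-! ### Nodal cubics and calculus in their rational parameter. -/

section NodalCurve

variable (s : ℂ)

/-- The coordinate `x` of the nodal curve `y² = x³ - 3 s² x + 2 s³`. -/
def nodalX (z : ℂ) : ℂ := z ^ 2 - 2 * s

/-- The function `y / x` on the nodal curve. -/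
def nodalEta (z : ℂ) : ℂ := z * (z ^ 2 - 3 * s) / nodalX s z

/-- The coefficient of the vector field `D` in the parameter `z`. -/
def nodalField (z : ℂ) : ℂ := z ^ 2 - 3 * s

/-- The functions on the nodal curve in terms of its parameter. -/
def nodalFun (z : ℂ) (i : ℤ) : ℂ := curveFun (nodalX s z) (nodalEta s z) i

/-- The derivatives of the functions on the nodal curve. -/
def nodalFunDeriv (z : ℂ) (i : ℤ) : ℂ :=
  curveFunDeriv (-3 * s ^ 2) (nodalX s z) (nodalEta s z) i

/-- The singular part of the kernel in terms of the parameters. -/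
def nodalKappa (z w : ℂ) : ℂ := -(z ^ 2 - z * w + w ^ 2 - 3 * s) / (z - w)

variable {s} {z w : ℂ}

theorem nodal_curve (hz : nodalX s z ≠ 0) : nodalX s z ^ 2 * nodalEta s z ^ 2 =
    nodalX s z ^ 3 + -3 * s ^ 2 * nodalX s z + 2 * s ^ 3 := by
  rw [← mul_pow, nodalEta, mul_div_cancel₀ _ hz, nodalX]
  ring

/-- Both `y₁ + y₂` and `x₁ - x₂` contain the factor `z + w`; it cancels. -/
theorem nodal_kappa_eq (hz : nodalX s z ≠ 0) (hw : nodalX s w ≠ 0)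
    (h : nodalX s z ≠ nodalX s w) :
    -(nodalX s z * nodalEta s z + nodalX s w * nodalEta s w) / (nodalX s z - nodalX s w) =
      nodalKappa s z w := by
  have h1 : z ^ 2 - w ^ 2 ≠ 0 := fun h0 => h (by rw [nodalX, nodalX]; linear_combination h0)
  have h2 : z - w ≠ 0 := fun h0 => h1 (by linear_combination (z + w) * h0)
  rw [nodalEta, nodalEta, mul_div_cancel₀ _ hz, mul_div_cancel₀ _ hw, nodalKappa,
    div_eq_div_iff (by rw [nodalX, nodalX]; convert h1 using 1; ring) h2, nodalX, nodalX]
  ring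

theorem hasDerivAt_nodalX : HasDerivAt (nodalX s) (2 * z) z :=
  ((hasDerivAt_pow 2 z).sub_const (2 * s)).congr_deriv (by simp)

theorem differentiableAt_nodalEta (hz : nodalX s z ≠ 0) : DifferentiableAt ℂ (nodalEta s) z := by
  unfold nodalEta
  exact DifferentiableAt.div (by fun_prop) hasDerivAt_nodalX.differentiableAt hz

theorem hasDerivAt_nodalX_zpow (hz : nodalX s z ≠ 0) (k : ℤ) :
    HasDerivAt (fun z => nodalX s z ^ k) (k * nodalX s z ^ (k - 1) * (2 * z)) z :=
  (hasDerivAt_zpow k _ (Or.inl hz)).comp z hasDerivAt_nodalX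

theorem eventually_nodalX_ne (hz : nodalX s z ≠ w) : ∀ᶠ z' in nhds z, nodalX s z' ≠ w :=
  (hasDerivAt_nodalX (s := s) (z := z)).continuousAt.eventually_ne hz

/-- This identifies the vector field `D` with `(z² - 3s) d/dz`: applied to `x = z² - 2s` it gives
`2z(z² - 3s) = 2y`. -/
theorem exists_hasDerivAt_nodalFun (hz : nodalX s z ≠ 0) (i : ℤ) :
    ∃ d, HasDerivAt (fun z => nodalFun s z i) d z ∧ nodalField s z * d = nodalFunDeriv s z i := by
  have hη : nodalX s z * nodalEta s z = z * (z ^ 2 - 3 * s) := by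
    rw [nodalEta, mul_div_cancel₀ _ hz]
  rcases Int.even_or_odd' i with ⟨k, rfl | h⟩
  · refine ⟨_, ((hasDerivAt_nodalX_zpow hz k).congr_of_eventuallyEq
      (Filter.Eventually.of_forall fun z => curveFun_even _ _ k)), ?_⟩
    rw [nodalFunDeriv, curveFunDeriv_even, nodalField, zpow_sub_one₀ hz]
    have : nodalX s z * (nodalX s z)⁻¹ = 1 := mul_inv_cancel₀ hz
    linear_combination (-2 * k * nodalX s z ^ k * (nodalX s z)⁻¹) * hη
      + 2 * k * nodalX s z ^ k * nodalEta s z * this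
  · obtain ⟨k, rfl⟩ : ∃ k, i = 2 * k + 3 := ⟨k - 1, by omega⟩
    have hd := (hasDerivAt_nodalX_zpow hz k).mul
      ((hasDerivAt_pow 3 z).sub ((hasDerivAt_id z).const_mul (3 * s)))
    refine ⟨_, hd.congr_of_eventuallyEq ?_, ?_⟩
    · filter_upwards [eventually_nodalX_ne hz] with z' hz'
      simp only [nodalFun, (curveFun_shifts (nodalEta s z') k hz').2.1, Pi.mul_apply, Pi.sub_apply]
      rw [mul_assoc, nodalEta, mul_div_cancel₀ _ hz', id]
      ring
    · rw [nodalFunDeriv, curveFunDeriv_odd, nodalField, zpow_sub_one₀ hz]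
      have h1 : nodalX s z * (nodalX s z)⁻¹ = 1 := mul_inv_cancel₀ hz
      have h2 : nodalX s z = z ^ 2 - 2 * s := rfl
      simp only [id, Pi.sub_apply]
      generalize nodalX s z ^ k = u
      generalize nodalEta s z = η at *
      generalize nodalX s z = x at *
      have h3 : x * η ^ 2 = (z * (z ^ 2 - 3 * s)) ^ 2 * x⁻¹ := by
        rw [← hη]; linear_combination (-x * η ^ 2) * h1
      rw [mul_assoc (2 * (k : ℂ)), h3]
      subst h2
      push_cast
      ring

theorem differentiableAt_nodalFunDeriv (hz : nodalX s z ≠ 0) (i : ℤ) :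
    DifferentiableAt ℂ (fun z => nodalFunDeriv s z i) z := by
  have h1 := fun k => (hasDerivAt_nodalX_zpow hz k).differentiableAt
  have h2 := differentiableAt_nodalEta hz
  have h3 := (hasDerivAt_nodalX (s := s) (z := z)).differentiableAt
  unfold nodalFunDeriv curveFunDeriv
  split_ifs
  · exact ((h1 _).mul h2).const_mul _
  · exact (h1 _).mul ((((h3.const_mul _).mul (h2.pow 2)).add ((h3.pow 2).const_mul 3)).add_const _)

/-- The second derivatives of the functions on the nodal curve. -/
def nodalFunDeriv₂ (s z : ℂ) (i : ℤ) : ℂ :=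
  nodalField s z * deriv (fun z => nodalFunDeriv s z i) z

/-- The derivative of `nodalKappa` with respect to its first argument. -/
def nodalKappaDeriv (s z w : ℂ) : ℂ :=
  nodalField s z * (-(z ^ 2 - 2 * z * w + 3 * s) / (z - w) ^ 2)

theorem hasDerivAt_nodalKappa (h : z ≠ w) :
    HasDerivAt (fun z => nodalKappa s z w) (-(z ^ 2 - 2 * z * w + 3 * s) / (z - w) ^ 2) z := by
  have h' : z - w ≠ 0 := sub_ne_zero.mpr h
  have hd := ((((hasDerivAt_pow 2 z).sub ((hasDerivAt_id z).mul_const w)).add_const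
    (w ^ 2)).sub_const (3 * s)).neg.div ((hasDerivAt_id z).sub_const w) h'
  refine hd.congr_deriv ?_
  simp only [id, Pi.sub_apply, Pi.neg_apply]
  field_simp
  push_cast
  ring

/-- The double poles at `z = w` cancel. This is the condition `hω` of `dirDeriv₃_jacobiSum`, with `ω
= -z²`. -/
theorem nodalKappaDeriv_sub (h : z ≠ w) :
    nodalKappaDeriv s z w - nodalKappaDeriv s w z = -z ^ 2 - -w ^ 2 := by
  have h' : z - w ≠ 0 := sub_ne_zero.mpr h
  have h'' : w - z ≠ 0 := sub_ne_zero.mpr h.symm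
  rw [nodalKappaDeriv, nodalKappaDeriv, nodalField, nodalField,
    show (w - z) ^ 2 = (z - w) ^ 2 by ring]
  field_simp
  ring

/-- The derivative of the kernel along the curve. -/
theorem hasDerivAt_nodalKernel (n : ℂ) (hz : nodalX s z ≠ 0) (h : z ≠ w) (i j : ℤ) :
    ∃ d, HasDerivAt (fun z => kernel n (nodalKappa s z w) (nodalFun s z i) (nodalFun s w i)
      (nodalFunDeriv s z i) (nodalFunDeriv s w i) (nodalFun s z j) (nodalFun s w j)
      (nodalFunDeriv s z j) (nodalFunDeriv s w j)) d z ∧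
    nodalField s z * d = kernelDeriv n (nodalKappa s z w) (nodalKappaDeriv s z w)
      (nodalFun s z i) (nodalFun s w i)
      (nodalFunDeriv s z i) (nodalFunDeriv s w i) (nodalFunDeriv₂ s z i)
      (nodalFun s z j) (nodalFun s w j)
      (nodalFunDeriv s z j) (nodalFunDeriv s w j) (nodalFunDeriv₂ s z j) := by
  obtain ⟨di, hi, hi'⟩ := exists_hasDerivAt_nodalFun hz i
  obtain ⟨dj, hj, hj'⟩ := exists_hasDerivAt_nodalFun hz j
  have hi₂ := (differentiableAt_nodalFunDeriv hz i).hasDerivAt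
  have hj₂ := (differentiableAt_nodalFunDeriv hz j).hasDerivAt
  have hκ := hasDerivAt_nodalKappa (s := s) h
  refine ⟨_, (((((hκ.const_mul n).mul ((hi.mul_const _).sub (hj.const_mul _))).add
    (hi₂.mul_const _)).sub (hi.mul_const _)).add (hj.const_mul _)).sub (hj₂.const_mul _), ?_⟩
  simp only [kernelDeriv, nodalFunDeriv₂, nodalKappaDeriv, ← hi', ← hj', Pi.sub_apply]
  ring

end NodalCurve

/-! ### The points of the nodal curve span. -/

section Span

/-- The functions on the nodal curve as polynomials in the parameter, with the parameter itself
inserted in degree one. -/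
def nodalSequence (s : ℂ) : Polynomial.Sequence ℂ where
  elems' k := if Even k then (Polynomial.X ^ 2 - Polynomial.C (2 * s)) ^ (k / 2)
    -- A `Polynomial.Sequence` needs a member of every degree; degree 1 corresponds to no generator
    -- and is only filled in.
    else if k = 1 then Polynomial.X
    else (Polynomial.X ^ 2 - Polynomial.C (2 * s)) ^ ((k - 3) / 2) *
      (Polynomial.X * (Polynomial.X ^ 2 - Polynomial.C (3 * s)))
  degree_eq' k := by
    have h2 : ∀ c : ℂ, (Polynomial.X ^ 2 - Polynomial.C c).degree = 2 := fun c =>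
      Polynomial.degree_X_pow_sub_C two_pos c
    split_ifs with h h1
    · obtain ⟨m, rfl⟩ := h
      rw [Polynomial.degree_pow, h2, show (m + m) / 2 = m by omega]
      push_cast
      rw [nsmul_eq_mul]
      ring
    · rw [h1, Polynomial.degree_X]; rfl
    · obtain ⟨m, rfl⟩ : ∃ m, k = 2 * m + 3 := by
        rw [Nat.even_iff] at h
        exact ⟨(k - 3) / 2, by omega⟩
      rw [Polynomial.degree_mul, Polynomial.degree_mul, Polynomial.degree_pow, h2, h2,
        Polynomial.degree_X, show (2 * m + 3 - 3) / 2 = m by omega]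
      push_cast
      rw [nsmul_eq_mul]
      norm_num
      ring_nf

theorem nodalFun_eq_eval {n : ℕ} {s z : ℂ} (hz : nodalX s z ≠ 0) (a : Index n) :
    nodalFun s z a = (nodalSequence s (a : ℤ).toNat).eval z := by
  obtain ⟨a, ha⟩ := a
  change nodalFun s z a = Polynomial.eval z (if _ then _ else _)
  rcases Int.even_or_odd' a with ⟨k, rfl | h⟩
  · obtain ⟨k, rfl⟩ := Int.eq_ofNat_of_zero_le (show 0 ≤ k by omega)
    have : Even (2 * (k : ℤ)).toNat := by rw [Nat.even_iff]; omega
    rw [if_pos this, nodalFun, curveFun_even, show (2 * (k : ℤ)).toNat / 2 = k by omega]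
    simp [nodalX]
  · obtain ⟨k, rfl⟩ : ∃ k : ℕ, a = 2 * k + 3 := ⟨(k - 1).toNat, by omega⟩
    have h1 : ¬ Even (2 * (k : ℤ) + 3).toNat := by rw [Nat.even_iff]; omega
    have h2 : (2 * (k : ℤ) + 3).toNat ≠ 1 := by omega
    rw [if_neg h1, if_neg h2, nodalFun, (curveFun_shifts _ k hz).2.1,
      show ((2 * (k : ℤ) + 3).toNat - 3) / 2 = k by omega, mul_assoc, nodalEta,
      mul_div_cancel₀ _ hz]
    simp [nodalX]

instance (n : ℕ) : Finite (Index n) :=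
  Set.Finite.to_subtype (s := {a : ℤ | a = 0 ∨ (2 ≤ a ∧ a ≤ n)})
    ((Set.finite_Icc (0 : ℤ) n).subset fun a ha => by
      rw [Set.mem_Icc]
      rcases ha with ha | ha <;> omega)

instance (n : ℕ) : Fintype (Index n) := Fintype.ofFinite _

variable {n : ℕ} {s : ℂ}

/-- The values of the functions at almost all points of the curve span. -/
theorem eq_zero_of_sum_nodalFun (v : Index n → ℂ) (T : Set ℂ) (hT : T.Finite)
    (h : ∀ z ∉ T, nodalX s z ≠ 0 → ∑ a : Index n, nodalFun s z a * v a = 0) : v = 0 := by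
  have hX : {z | nodalX s z = 0}.Finite := by
    have hne : (Polynomial.X ^ 2 - Polynomial.C (2 * s)) ≠ 0 :=
      Polynomial.X_pow_sub_C_ne_zero two_pos _
    refine (Polynomial.finite_setOfPred_isRoot hne).subset fun z hz => ?_
    simpa [Polynomial.IsRoot, nodalX] using hz
  have hinj : Function.Injective fun a : Index n => (a : ℤ).toNat := fun a b hab => by
    have ha := a.2
    have hb := b.2
    refine Subtype.ext ?_
    simp only at hab
    omega
  have hli := (nodalSequence s).linearIndependent.comp _ hinj
  have h0 : ∑ a, v a • nodalSequence s ((a : ℤ).toNat) = 0 := by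
    refine Polynomial.eq_zero_of_infinite_isRoot _ ((hT.union hX).infinite_compl.mono ?_)
    intro z hz
    simp only [Set.mem_compl_iff, Set.mem_union, not_or] at hz
    rw [Set.mem_ofPred_eq, Polynomial.IsRoot, Polynomial.eval_finsetSum, ← h z hz.1 hz.2]
    refine Finset.sum_congr rfl fun a _ => ?_
    rw [Polynomial.eval_smul, nodalFun_eq_eval hz.2, smul_eq_mul, mul_comm]
  exact funext (Fintype.linearIndependent_iff.mp hli v h0)

/-- Evaluation of the generators at a point of the nodal curve. -/
def nodalPoint (n : ℕ) (s z : ℂ) (a : Index n) : ℂ := nodalFun s z a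

/-- A form of positive degree whose derivatives at almost all points of the curve vanish is
zero. -/
theorem eq_zero_of_dirDeriv_nodalPoint {p : PolyAlg n} {d : ℕ} (hp : p.IsHomogeneous d)
    (hd : d ≠ 0) (T : Set ℂ) (hT : T.Finite)
    (h : ∀ z ∉ T, nodalX s z ≠ 0 → dirDeriv (nodalPoint n s z) p = 0) : p = 0 := by
  -- For a fixed monomial `m`, the coefficients of the partial derivatives form a vector orthogonal
  -- to almost all points of the curve.
  refine eq_zero_of_pderiv_eq_zero hp hd fun a => MvPolynomial.ext _ _ fun m => ?_
  refine congrFun (eq_zero_of_sum_nodalFun (s := s) (fun a => coeff m (pderiv a p)) T hT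
    fun z hz hz' => ?_) a
  have h1 := congrArg (coeff m) (h z hz hz')
  rw [dirDeriv_eq_sum, coeff_sum] at h1
  simpa only [coeff_C_mul, coeff_zero, nodalPoint] using h1

end Span

/-! ### The three brackets, the Jacobi identity on nodal curves, and compatibility. -/

section Brackets

variable (n : ℕ)

/-- The value of `{e_a, e_b}_i` in the polynomial algebra. -/
def generatorValue (i : Fin 3) (a b : Index n) : PolyAlg n :=
  (exists_rename_eq_polyFormula i a b).choose

theorem rename_generatorValue (i : Fin 3) (a b : Index n) :
    rename (Subtype.val : Index n → ℤ) (generatorValue n i a b) = polyFormula n i a b :=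
  (exists_rename_eq_polyFormula i a b).choose_spec

theorem generatorValue_swap (i : Fin 3) (a b : Index n) :
    generatorValue n i a b = -generatorValue n i b a := by
  apply rename_injective _ (Subtype.val_injective (p := fun a : ℤ => a = 0 ∨ (2 ≤ a ∧ a ≤ n)))
  rw [map_neg, rename_generatorValue, rename_generatorValue, polyFormula_swap]

theorem generatorValue_self (i : Fin 3) (a : Index n) : generatorValue n i a a = 0 :=
  self_eq_neg.mp (generatorValue_swap n i a a)

theorem isHomogeneous_generatorValue (i : Fin 3) (a b : Index n) :
    (generatorValue n i a b).IsHomogeneous 2 := by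
  rw [← IsHomogeneous.rename_isHomogeneous_iff
    (Subtype.val_injective (p := fun a : ℤ => a = 0 ∨ (2 ≤ a ∧ a ≤ n))), rename_generatorValue]
  exact isHomogeneous_polyFormula n i a b

/-- The bracket `{ , }_i`. -/
def bracket (i : Fin 3) : PolyAlg n →ₗ[ℂ] PolyAlg n →ₗ[ℂ] PolyAlg n :=
  biderivationOfMatrix (generatorValue n i)

theorem bracket_X_X (i : Fin 3) (a b : Index n) :
    bracket n i (X a) (X b) = generatorValue n i a b :=
  biderivationOfMatrix_X_X _ a b

theorem isAltBiderivation_bracket (i : Fin 3) : IsAltBiderivation (bracket n i) :=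
  isAltBiderivation_biderivationOfMatrix (generatorValue_self n i) (generatorValue_swap n i)

theorem isAltBiderivation_sum (c : Fin 3 → ℂ) : IsAltBiderivation (∑ i, c i • bracket n i) :=
  IsAltBiderivation.sum _ fun i => (isAltBiderivation_bracket n i).smul (c i)

theorem agreesWithFormula_bracket (i : Fin 3) : AgreesWithFormula n i (bracket n i) := by
  intro a b
  rw [toSeries, bracket_X_X, rename_generatorValue, coe_polyFormula]

theorem toSeries_injective : Function.Injective (toSeries (n := n)) :=
  (MvPolynomial.coe_injective ℤ ℂ).comp (rename_injective _ Subtype.val_injective)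

/-- The coefficients of the bracket attached to the nodal curve. -/
def nodalCoeff (s : ℂ) : Fin 3 → ℂ := ![1, -4 * (-3 * s ^ 2), -4 * (2 * s ^ 3)]

/-- The bracket attached to the nodal curve. -/
def nodalBracket (s : ℂ) : PolyAlg n →ₗ[ℂ] PolyAlg n →ₗ[ℂ] PolyAlg n :=
  ∑ i, nodalCoeff s i • bracket n i

theorem rename_nodalBracket (s : ℂ) (a b : Index n) :
    rename (Subtype.val : Index n → ℤ) (nodalBracket n s (X a) (X b)) =
      curvePoly n (-3 * s ^ 2) (2 * s ^ 3) a b := by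
  simp only [nodalBracket, nodalCoeff, Fin.sum_univ_three, LinearMap.add_apply,
    LinearMap.smul_apply, map_add, map_smul, bracket_X_X, rename_generatorValue, curvePoly,
    Matrix.cons_val, one_smul]

theorem isHomogeneous_nodalBracket (s : ℂ) (a b : Index n) :
    (nodalBracket n s (X a) (X b)).IsHomogeneous 2 := by
  simp only [nodalBracket, LinearMap.sum_apply, LinearMap.smul_apply, bracket_X_X]
  refine IsHomogeneous.sum _ _ _ fun i _ => ?_
  exact (homogeneousSubmodule (Index n) ℂ 2).smul_mem _ (isHomogeneous_generatorValue n i a b)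

variable {n} {s : ℂ}

theorem dirDeriv₂_nodalBracket {z w : ℂ} (hz : nodalX s z ≠ 0) (hw : nodalX s w ≠ 0)
    (h : nodalX s z ≠ nodalX s w) (a b : Index n) :
    dirDeriv (nodalPoint n s z) (dirDeriv (nodalPoint n s w) (nodalBracket n s (X a) (X b))) =
      C (kernel n (nodalKappa s z w) (nodalFun s z a) (nodalFun s w a)
        (nodalFunDeriv s z a) (nodalFunDeriv s w a) (nodalFun s z b) (nodalFun s w b)
        (nodalFunDeriv s z b) (nodalFunDeriv s w b)) := by
  have hp : ∀ z, nodalPoint n s z = nodalFun s z ∘ Subtype.val := fun z => rfl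
  apply rename_injective _ (Subtype.val_injective (p := fun a : ℤ => a = 0 ∨ (2 ≤ a ∧ a ≤ n)))
  rw [hp, hp, rename_dirDeriv, rename_dirDeriv, rename_nodalBracket, rename_C]
  refine (dirDeriv₂_curvePoly hz hw h (nodal_curve hz) (nodal_curve hw) _ _).trans ?_
  rw [curveKernel, nodal_kappa_eq hz hw h]
  rfl

/-- The derivative of the point of the nodal curve. -/
def nodalPointDeriv (n : ℕ) (s z : ℂ) (a : Index n) : ℂ := nodalFunDeriv s z a

/-- With the point `w` fixed, the polarised bracket is linear in the other direction, so putting the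
derivative of the point there amounts to differentiating the kernel along the curve. -/
theorem dirDeriv₂_nodalBracket_deriv {z w : ℂ} (hz : nodalX s z ≠ 0) (hw : nodalX s w ≠ 0)
    (h : nodalX s z ≠ nodalX s w) (a b : Index n) :
    dirDeriv (nodalPoint n s w)
        (dirDeriv (nodalPointDeriv n s z) (nodalBracket n s (X a) (X b))) =
      C (kernelDeriv n (nodalKappa s z w) (nodalKappaDeriv s z w)
        (nodalFun s z a) (nodalFun s w a)
        (nodalFunDeriv s z a) (nodalFunDeriv s w a) (nodalFunDeriv₂ s z a)
        (nodalFun s z b) (nodalFun s w b)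
        (nodalFunDeriv s z b) (nodalFunDeriv s w b) (nodalFunDeriv₂ s z b)) := by
  obtain ⟨q, hq⟩ := exists_dirDeriv_eq_C
    (isHomogeneous_dirDeriv (isHomogeneous_nodalBracket n s a b) (nodalPoint n s w))
  have hzw : z ≠ w := fun h' => h (by rw [h'])
  obtain ⟨d, hd, hd'⟩ := hasDerivAt_nodalKernel (s := s) n hz hzw a b
  rw [dirDeriv_comm, hq, ← hd']
  congr 1
  choose f hf hf' using fun c : Index n => exists_hasDerivAt_nodalFun hz (c : ℤ)
  have hsum : HasDerivAt (fun z => ∑ c : Index n, nodalFun s z c * q c) (∑ c, f c * q c) z :=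
    HasDerivAt.fun_sum fun c _ => (hf c).mul_const (q c)
  -- The kernel formula is only known away from coincidences of `x`; these conditions are open,
  -- which is enough to compare derivatives at `z`.
  have heq : (fun z => ∑ c : Index n, nodalFun s z c * q c) =ᶠ[nhds z] fun z =>
      kernel n (nodalKappa s z w) (nodalFun s z a) (nodalFun s w a) (nodalFunDeriv s z a)
        (nodalFunDeriv s w a) (nodalFun s z b) (nodalFun s w b) (nodalFunDeriv s z b)
        (nodalFunDeriv s w b) := by
    filter_upwards [eventually_nodalX_ne hz, eventually_nodalX_ne h] with z' hz' hzw'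
    exact C_injective _ _ ((hq (nodalPoint n s z')).symm.trans
      (dirDeriv₂_nodalBracket hz' hw hzw' a b))
  rw [← hsum.unique (hd.congr_of_eventuallyEq heq), Finset.mul_sum]
  refine Finset.sum_congr rfl fun c _ => ?_
  rw [← mul_assoc, hf', nodalPointDeriv]

theorem jacobiSum_nodalBracket (a b c : Index n) :
    jacobiSum (nodalBracket n s) (nodalBracket n s) (X a) (X b) (X c) = 0 := by
  have hB : IsAltBiderivation (nodalBracket n s) := isAltBiderivation_sum n _
  have key : ∀ z : Fin 3 → ℂ, (∀ i, nodalX s (z i) ≠ 0) →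
      (∀ i j, i ≠ j → nodalX s (z i) ≠ nodalX s (z j)) →
      dirDeriv (nodalPoint n s (z 0)) (dirDeriv (nodalPoint n s (z 1))
        (dirDeriv (nodalPoint n s (z 2))
          (jacobiSum (nodalBracket n s) (nodalBracket n s) (X a) (X b) (X c)))) = 0 := by
    intro z h0 h1
    refine dirDeriv₃_jacobiSum hB n (fun i j => nodalKappa s (z i) (z j))
      (fun i j => nodalKappaDeriv s (z i) (z j)) (fun i => -z i ^ 2) (fun i j => ?_)
      (fun i j hij => nodalKappaDeriv_sub fun h => h1 i j hij (by rw [h]))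
      (fun i => nodalPoint n s (z i)) (fun i => nodalPointDeriv n s (z i))
      (fun i a => nodalFunDeriv₂ s (z i) a)
      (fun i j a b hij => dirDeriv₂_nodalBracket (h0 i) (h0 j) (h1 i j hij) a b)
      (fun i j a b hij => dirDeriv₂_nodalBracket_deriv (h0 i) (h0 j) (h1 i j hij) a b) a b c
    simp only [nodalKappa]
    rw [← neg_sub (z i) (z j), div_neg]
    congr 2
    ring
  have hfin : ∀ w, {z | nodalX s z = nodalX s w}.Finite := by
    intro w
    refine (Set.toFinite {w, -w}).subset fun z hz => ?_
    have h : z ^ 2 = w ^ 2 := by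
      have hz' : z ^ 2 - 2 * s = w ^ 2 - 2 * s := hz
      linear_combination hz'
    simpa using sq_eq_sq_iff_eq_or_eq_neg.mp h
  have hom := isHomogeneous_jacobiSum hB (isHomogeneous_nodalBracket n s) a b c
  -- The cubic form is tested against one point after another. Each new point avoids the finitely
  -- many parameters at which `x` takes the value of an earlier point.
  refine eq_zero_of_dirDeriv_nodalPoint (s := s) hom (by norm_num) ∅ Set.finite_empty
    fun z₂ _ h₂ => ?_
  have hom₂ := isHomogeneous_dirDeriv hom (nodalPoint n s z₂)
  refine eq_zero_of_dirDeriv_nodalPoint (s := s) hom₂ (by norm_num) _ (hfin z₂)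
    fun z₁ h₁₂ h₁ => ?_
  have hom₁ := isHomogeneous_dirDeriv hom₂ (nodalPoint n s z₁)
  refine eq_zero_of_dirDeriv_nodalPoint (s := s) hom₁ (by norm_num) _ ((hfin z₁).union (hfin z₂))
    fun z₀ h₀ h₀' => ?_
  simp only [Set.mem_union, Set.mem_ofPred_eq, not_or] at h₀ h₁₂
  refine key ![z₀, z₁, z₂] (fun i => ?_) fun i j hij => ?_
  · fin_cases i <;> assumption
  · fin_cases i <;> fin_cases j <;> first
      | exact absurd rfl hij
      | exact h₀.1
      | exact h₀.2
      | exact h₁₂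
      | exact h₀.1 ∘ Eq.symm
      | exact h₀.2 ∘ Eq.symm
      | exact h₁₂ ∘ Eq.symm

theorem jacobiSum_sum_smul {R A ι : Type*} [CommRing R] [CommRing A] [Algebra R A] [Fintype ι]
    (c : ι → R) (B : ι → A →ₗ[R] A →ₗ[R] A) (f g h : A) :
    jacobiSum (∑ i, c i • B i) (∑ i, c i • B i) f g h =
      ∑ i, ∑ j, (c i * c j) • jacobiSum (B i) (B j) f g h := by
  have key : ∀ f g h : A, (∑ i, c i • B i) f ((∑ i, c i • B i) g h) =
      ∑ i, ∑ j, (c i * c j) • B i f (B j g h) := by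
    intro f g h
    simp only [LinearMap.sum_apply, LinearMap.smul_apply, map_sum, map_smul, Finset.smul_sum,
      mul_smul]
    rw [Finset.sum_comm]
    exact Finset.sum_congr rfl fun i _ => Finset.sum_congr rfl fun j _ => smul_comm _ _ _
  simp only [jacobiSum, key, smul_add, Finset.sum_add_distrib]

/-- A polynomial function with vanishing values has vanishing coefficients. -/
theorem eq_zero_of_forall_nodal {u v w x y z : ℂ}
    (h : ∀ s : ℂ, u + s ^ 2 * v + s ^ 3 * w + s ^ 4 * x + s ^ 5 * y + s ^ 6 * z = 0) :
    u = 0 ∧ v = 0 ∧ w = 0 ∧ x = 0 ∧ y = 0 ∧ z = 0 := by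
  -- The values at `±1` and `±2` separate off the odd powers `s³`, `s⁵`; the three even powers `s²`,
  -- `s⁴`, `s⁶` then follow from 1, 2 and 3.
  have h0 := h 0
  have h1 := h 1
  have h2 := h (-1)
  have h3 := h 2
  have h4 := h (-2)
  have h5 := h 3
  have hu : u = 0 := by linear_combination h0
  subst hu
  have hy : y = 0 := by linear_combination (h3 - h4 - 8 * (h1 - h2)) / 48
  have hw : w = 0 := by linear_combination (32 * (h1 - h2) - (h3 - h4)) / 48
  subst hy hw
  have hz : z = 0 := by linear_combination (h5 + 15 / 2 * (h1 + h2) - 3 * (h3 + h4)) / 360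
  subst hz
  have hx : x = 0 := by linear_combination ((h3 + h4) / 2 - 2 * (h1 + h2)) / 12
  subst hx
  exact ⟨rfl, by linear_combination h1, rfl, rfl, rfl, rfl⟩

/-- The Jacobi sum of a combination is a quadratic form in its coefficients, with six independent
entries. On the curve `(1, 12s², -8s³)` the six quadratic monomials are multiples of `1, s², s³, s⁴,
s⁵, s⁶`, so vanishing for all `s` forces each entry to vanish. -/
theorem jacobiSum_sum_bracket (c : Fin 3 → ℂ) (a b d : Index n) :
    jacobiSum (∑ i, c i • bracket n i) (∑ i, c i • bracket n i) (X a) (X b) (X d) = 0 := by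
  rw [jacobiSum_sum_smul]
  refine MvPolynomial.ext _ _ fun m => ?_
  generalize hT : (fun i j => coeff m (jacobiSum (bracket n i) (bracket n j) (X a) (X b) (X d)))
    = T
  have hT' : ∀ i j, coeff m (jacobiSum (bracket n i) (bracket n j) (X a) (X b) (X d)) = T i j :=
    fun i j => congrFun (congrFun hT i) j
  have h : ∀ s : ℂ, _ = _ := fun s => congrArg (coeff m)
    ((jacobiSum_sum_smul (nodalCoeff s) (bracket n) (X a) (X b) (X d)).symm.trans
      (jacobiSum_nodalBracket (s := s) a b d))
  simp only [coeff_add, coeff_smul, hT', coeff_zero, Fin.sum_univ_three, nodalCoeff,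
    Matrix.cons_val, smul_eq_mul] at h ⊢
  obtain ⟨h1, h2, h3, h4, h5, h6⟩ := eq_zero_of_forall_nodal (u := T 0 0)
    (v := 12 * (T 0 1 + T 1 0)) (w := -8 * (T 0 2 + T 2 0)) (x := 144 * T 1 1)
    (y := -96 * (T 1 2 + T 2 1)) (z := 64 * T 2 2) fun s => by linear_combination h s
  linear_combination c 0 * c 0 * h1 + c 0 * c 1 / 12 * h2 - c 0 * c 2 / 8 * h3
    + c 1 * c 1 / 144 * h4 - c 1 * c 2 / 96 * h5 + c 2 * c 2 / 64 * h6

theorem isPoissonBracket_sum (c : Fin 3 → ℂ) :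
    IsPoissonBracket ℂ (∑ i, c i • bracket n i) :=
  (isAltBiderivation_sum n c).isPoissonBracket fun a b d => jacobiSum_sum_bracket c a b d

theorem isPoissonBracket_bracket (i : Fin 3) : IsPoissonBracket ℂ (bracket n i) := by
  have h := isPoissonBracket_sum (n := n) (Pi.single i 1)
  simpa [Pi.single_apply] using h

end Brackets

end QuadraticPoisson

end

theorem proposition1 (n : ℕ) :
    ∃ B : Fin 3 → (QuadraticPoisson.PolyAlg n →ₗ[ℂ]
        QuadraticPoisson.PolyAlg n →ₗ[ℂ] QuadraticPoisson.PolyAlg n),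
      (∀ i, QuadraticPoisson.AgreesWithFormula n i (B i)
        ∧ QuadraticPoisson.IsPoissonBracket ℂ (B i))
      ∧ (∀ i P, QuadraticPoisson.AgreesWithFormula n i P →
          QuadraticPoisson.IsPoissonBracket ℂ P → P = B i)
      ∧ ∀ c : Fin 3 → ℂ, QuadraticPoisson.IsPoissonBracket ℂ (∑ i, c i • B i) := by
  refine ⟨QuadraticPoisson.bracket n, fun i => ⟨QuadraticPoisson.agreesWithFormula_bracket n i,
    QuadraticPoisson.isPoissonBracket_bracket i⟩, fun i P hP hP' => ?_,
    QuadraticPoisson.isPoissonBracket_sum⟩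
  refine hP'.isAltBiderivation.ext_X (QuadraticPoisson.isAltBiderivation_bracket n i)
    fun a b => QuadraticPoisson.toSeries_injective n ?_
  rw [hP, QuadraticPoisson.agreesWithFormula_bracket]
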